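/- **Structures.** A *structure type* $\mathbb S$ consists of operation symbols $o$, each with an arity $n_o\in\mathbb N$, and of cell symbols $c$, each with a pair of formal composites $s_c,t_c$ of operations in the same number of variables. An $\mathbb S$-*structure* on a category $\mathcal C$ assigns to every $o$ a functor $\mathcal C^{n_o}\to\mathcal C$ and to every $c$ a natural transformation $s_c\Rightarrow t_c$ between the corresponding composite functors. (Examples: linear structures, tensor structures without unit, braidings, actions of a fixed monoidal category.) A *structure-preserving functor* is a functor $F$ with natural isomorphisms $o(FX_1,\dots,FX_{n})\cong F(o(X_1,\dots,X_n))$ for all $o$, compatible with all the natural transformations of the structures; a *structure-preserving natural isomorphism* is one compatible with these isomorphisms. The structure on an abelian category is *right exact* if all its operations are right exact in each variable separately. Let $\mathcal C$ be an abelian category with enough projectives and with a right exact $\mathbb S$-structure whose operations carry projective objects to projective objects, and let $\iota:\mathcal P\hookrightarrow\mathcal C$ be its full subcategory of projective objects, with the restricted structure. Let $\Phi$ be any property of $\mathbb S$-structured abelian categories (e.g. axioms such as the pentagon equation). An *abelian completion* of $\mathcal P$ relative to $\Phi$ is an abelian category $\mathcal D$ with right exact $\mathbb S$-structure and an additive structure-preserving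 functor $j:\mathcal P\to\mathcal D$ such that for every abelian category $\mathcal E$ with right exact $\mathbb S$-structure satisfying $\Phi$: every additive structure-preserving functor $F:\mathcal P\to\mathcal E$ is isomorphic to $G\circ j$ for some right exact structure-preserving functor $G:\mathcal D\to\mathcal E$, and any two right exact structure-preserving functors $G,H:\mathcal D\to\mathcal E$ with $G\circ j\cong H\circ j$ are isomorphic (all isomorphisms being structure-preserving). **Theorem.** 1. $(\mathcal C,\iota)$ is an abelian completion of $\mathcal P$ relative to every $\Phi$. 2. It is the unique one: if $\mathcal C$ and $\mathcal D$ satisfy $\Phi$ and $(\mathcal D,j)$ is an abelian completion of $\mathcal P$ relative to $\Phi$ (with $\mathcal E$ above ranging over categories of the same size as $\mathcal C$ and $\mathcal D$), then there is a structure-preserving equivalence $F:\mathcal C\to\mathcal D$ with $F\circ\iota\cong j$, and it is, up to structure-preserving natural isomorphism, the only right exact structure-preserving functor with this property. 3. If $\mathcal C'$, with projectives $\iota':\mathcal P'\hookrightarrow\mathcal C'$, satisfies the same assumptions as $\mathcal C$, then for every additive structure-preserving equivalence $E:\mathcal P\to\mathcal P'$ there is a structure-preserving equivalence $F:\mathcal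 C\to\mathcal C'$ with $F\circ\iota\cong\iota'\circ E$, and it is, up to structure-preserving natural isomorphism, the only right exact structure-preserving functor with this property. 4. In particular, the projective subcategory is a complete invariant of a finite tensor category. Let $\mathcal C,\mathcal C'$ be finite tensor categories over an algebraically closed field $k$, and regard their full subcategories $\mathcal P,\mathcal P'$ of projectives as $k$-linear tensor categories without unit. Then there is a $k$-linear monoidal equivalence $\mathcal C\to\mathcal C'$ if and only if there is a $k$-linear tensor equivalence $\mathcal P\to\mathcal P'$. Moreover, for every $k$-linear tensor equivalence $E:\mathcal P\to\mathcal P'$ there is a $k$-linear (unital) monoidal equivalence $F:\mathcal C\to\mathcal C'$ with $F\circ\iota\cong\iota'\circ E$ as tensor functors, and any two right exact $k$-linear monoidal functors $\mathcal C\to\mathcal C'$ with this property are monoidally isomorphic. -/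

import Mathlib

open CategoryTheory CategoryTheory.Limits MonoidalCategory

universe w₁ w₂ u v u' v' uP vP uE vE

set_option linter.checkUnivs false

/-! ### Additional structures on a category -/

/-- Formal expressions in `n` variables over a family of operation symbols with arities. -/
inductive StructTerm {Op : Type w₁} (arity : Op → ℕ) (n : ℕ) : Type w₁
  | var (i : Fin n) : StructTerm arity n
  | op (o : Op) (args : Fin (arity o) → StructTerm arity n) : StructTerm arity n

/-- A type of additional structure: operation symbols (to be interpreted as functors of several
variables) and cell symbols (to be interpreted as natural transformations between two functors
which are composites of operations). -/
structure StructType where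
  Op : Type w₁
  arity : Op → ℕ
  Cell : Type w₂
  cellArity : Cell → ℕ
  src (c : Cell) : StructTerm arity (cellArity c)
  tgt (c : Cell) : StructTerm arity (cellArity c)

/-- An interpretation of the operation symbols: a functor `C × ⋯ × C ⥤ C` for every symbol. -/
structure OpStr (S : StructType.{w₁, w₂}) (C : Type u) [Category.{v} C] where
  op (o : S.Op) : (Fin (S.arity o) → C) ⥤ C

/-- The functor of `n` variables denoted by a formal expression. -/
def OpStr.eval {S : StructType.{w₁, w₂}} {C : Type u} [Category.{v} C] (A : OpStr S C) {n : ℕ} :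
    StructTerm S.arity n → ((Fin n → C) ⥤ C)
  | .var i => Pi.eval (fun _ : Fin n => C) i
  | .op o args => Functor.pi' (fun j => A.eval (args j)) ⋙ A.op o

/-- A category structure of the given type: functors for the operation symbols and natural
transformations for the cell symbols. -/
structure Str (S : StructType.{w₁, w₂}) (C : Type u) [Category.{v} C] extends OpStr S C where
  cell (c : S.Cell) : toOpStr.eval (S.src c) ⟶ toOpStr.eval (S.tgt c)

/-- The functor `Y ↦ (X₁, …, Y, …, Xₙ)` inserting an object in the slot `i` of a family. -/
def insertSlot {C : Type u} [Category.{v} C] {n : ℕ} (X : Fin n → C) (i : Fin n) :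
    C ⥤ (Fin n → C) :=
  Functor.pi' (fun j => if j = i then 𝟭 C else (Functor.const C).obj (X j))

/-- All operations are right exact in each variable separately. -/
def OpStr.RightExact {S : StructType.{w₁, w₂}} {C : Type u} [Category.{v} C]
    (A : OpStr S C) : Prop :=
  ∀ (o : S.Op) (X : Fin (S.arity o) → C) (i : Fin (S.arity o)),
    PreservesFiniteColimits (insertSlot X i ⋙ A.op o)

/-- A class of objects is closed under all operations. -/
def OpStr.Closed {S : StructType.{w₁, w₂}} {C : Type u} [Category.{v} C]
    (A : OpStr S C) (Q : ObjectProperty C) : Prop :=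
  ∀ (o : S.Op) (X : Fin (S.arity o) → C), (∀ i, Q (X i)) → Q ((A.op o).obj X)

/-! ### Structure-preserving functors -/

/-- A functor commuting with the operations up to specified natural isomorphisms. -/
structure OpFunctor {S : StructType.{w₁, w₂}} {C : Type u} [Category.{v} C]
    {D : Type u'} [Category.{v'} D] (A : OpStr S C) (B : OpStr S D) where
  functor : C ⥤ D
  opIso (o : S.Op) (X : Fin (S.arity o) → C) :
    (B.op o).obj (fun i => functor.obj (X i)) ≅ functor.obj ((A.op o).obj X)
  opIso_natural (o : S.Op) (X Y : Fin (S.arity o) → C) (f : X ⟶ Y) :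
    (B.op o).map (X := fun i => functor.obj (X i)) (Y := fun i => functor.obj (Y i))
        (fun i => functor.map (f i)) ≫ (opIso o Y).hom =
      (opIso o X).hom ≫ functor.map ((A.op o).map f)

/-- The induced isomorphisms for all composites of operations. -/
def OpFunctor.termIso {S : StructType.{w₁, w₂}} {C : Type u} [Category.{v} C]
    {D : Type u'} [Category.{v'} D] {A : OpStr S C} {B : OpStr S D} (F : OpFunctor A B) {n : ℕ} :
    (t : StructTerm S.arity n) → (X : Fin n → C) →
      ((B.eval t).obj (fun i => F.functor.obj (X i)) ≅ F.functor.obj ((A.eval t).obj X))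
  | .var _, _ => Iso.refl _
  | .op o args, X =>
      (B.op o).mapIso (Pi.isoMk (fun j => F.termIso (args j) X)) ≪≫
        F.opIso o (fun j => (A.eval (args j)).obj X)

theorem map_square_comp {C : Type u} [Category.{v} C] {D : Type u'} [Category.{v'} D]
    (G : C ⥤ D) {X X' Y Y' : C} {Z Z' : D} {m : X ⟶ X'} {p' : X' ⟶ Y'} {p : X ⟶ Y} {q : Y ⟶ Y'}
    (e : m ≫ p' = p ≫ q) {φ' : G.obj Y' ⟶ Z'} {φ : G.obj Y ⟶ Z} {r : Z ⟶ Z'}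
    (h : G.map q ≫ φ' = φ ≫ r) :
    G.map m ≫ (G.map p' ≫ φ') = (G.map p ≫ φ) ≫ r := by
  rw [← Category.assoc, ← G.map_comp, e, G.map_comp, Category.assoc, h, Category.assoc]

theorem OpFunctor.termIso_natural {S : StructType.{w₁, w₂}} {C : Type u} [Category.{v} C]
    {D : Type u'} [Category.{v'} D] {A : OpStr S C} {B : OpStr S D} (F : OpFunctor A B) {n : ℕ}
    (t : StructTerm S.arity n) (X Y : Fin n → C) (f : X ⟶ Y) :
    (B.eval t).map (X := fun i => F.functor.obj (X i)) (Y := fun i => F.functor.obj (Y i))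
        (fun i => F.functor.map (f i)) ≫ (F.termIso t Y).hom =
      (F.termIso t X).hom ≫ F.functor.map ((A.eval t).map f) := by
  induction t with
  | var i => exact (Category.comp_id _).trans (Category.id_comp _).symm
  | op o args ih =>
    exact map_square_comp (B.op o) (X' := fun j => (B.eval (args j)).obj _)
      (p' := fun j => (F.termIso (args j) Y).hom) (p := fun j => (F.termIso (args j) X).hom)
      (funext ih) (F.opIso_natural o (fun j => (A.eval (args j)).obj X)
        (fun j => (A.eval (args j)).obj Y) (fun j => (A.eval (args j)).map f))

/-- A structure-preserving functor: it commutes with the operations up to specified natural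
isomorphisms, compatibly with all the natural transformations of the structure. -/
structure StrFunctor {S : StructType.{w₁, w₂}} {C : Type u} [Category.{v} C]
    {D : Type u'} [Category.{v'} D] (A : Str S C) (B : Str S D)
    extends OpFunctor A.toOpStr B.toOpStr where
  cell_comm (c : S.Cell) (X : Fin (S.cellArity c) → C) :
    (B.cell c).app (fun i => functor.obj (X i)) ≫ (toOpFunctor.termIso (S.tgt c) X).hom =
      (toOpFunctor.termIso (S.src c) X).hom ≫ functor.map ((A.cell c).app X)

/-- Composition of functors commuting with the operations. -/
def OpFunctor.comp {S : StructType.{w₁, w₂}} {C : Type u} [Category.{v} C]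
    {D : Type u'} [Category.{v'} D] {E : Type uE} [Category.{vE} E]
    {A : OpStr S C} {B : OpStr S D} {T : OpStr S E} (F : OpFunctor A B) (G : OpFunctor B T) :
    OpFunctor A T where
  functor := F.functor ⋙ G.functor
  opIso o X := G.opIso o (fun i => F.functor.obj (X i)) ≪≫ G.functor.mapIso (F.opIso o X)
  opIso_natural o X Y f := by
    have h1 := F.opIso_natural o X Y f
    have h2 := G.opIso_natural o (fun i => F.functor.obj (X i)) (fun i => F.functor.obj (Y i))
      (fun i => F.functor.map (f i))
    exact (Category.assoc _ _ _).symm.trans ((congrArg (· ≫ _) h2).trans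
      ((Category.assoc _ _ _).trans ((congrArg (_ ≫ ·)
        ((G.functor.map_comp _ _).symm.trans ((congrArg G.functor.map h1).trans
          (G.functor.map_comp _ _)))).trans (Category.assoc _ _ _).symm)))

theorem map_comp_comp {C : Type u} [Category.{v} C] {D : Type u'} [Category.{v'} D]
    {C' : Type uP} [Category.{vP} C'] (T : C ⥤ D) (G : C' ⥤ D) {X Y Z : C} {K L M : C'}
    {g : X ⟶ Y} {f : Y ⟶ Z} {b : K ⟶ L} {φ : L ⟶ M} {c : T.obj Z ⟶ G.obj L}
    {d : T.obj Y ⟶ G.obj K} {x : X ⟶ Z} (hx : x = g ≫ f)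
    (h : T.map f ≫ c = d ≫ G.map b) :
    T.map x ≫ (c ≫ G.map φ) = (T.map g ≫ d) ≫ G.map (b ≫ φ) := by
  rw [hx, T.map_comp, Category.assoc, ← Category.assoc (T.map f), h, G.map_comp]
  simp only [Category.assoc]

theorem OpFunctor.termIso_comp {S : StructType.{w₁, w₂}} {C : Type u} [Category.{v} C]
    {D : Type u'} [Category.{v'} D] {E : Type uE} [Category.{vE} E]
    {A : OpStr S C} {B : OpStr S D} {T : OpStr S E} (F : OpFunctor A B) (G : OpFunctor B T)
    {n : ℕ} (t : StructTerm S.arity n) (X : Fin n → C) :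
    ((F.comp G).termIso t X).hom =
      (G.termIso t (fun i => F.functor.obj (X i))).hom ≫
        G.functor.map (F.termIso t X).hom := by
  induction t with
  | var i => exact ((Category.id_comp _).trans (G.functor.map_id _)).symm
  | op o args ih =>
    exact map_comp_comp (T.op o) G.functor
      (Y := fun j => G.functor.obj ((B.eval (args j)).obj _))
      (g := fun j => (G.termIso (args j) _).hom)
      (f := fun j => G.functor.map (F.termIso (args j) X).hom) (funext ih)
      (G.opIso_natural o _ _ (fun j => (F.termIso (args j) X).hom))

/-- Composition of structure-preserving functors. -/
def StrFunctor.comp {S : StructType.{w₁, w₂}} {C : Type u} [Category.{v} C]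
    {D : Type u'} [Category.{v'} D] {E : Type uE} [Category.{vE} E]
    {A : Str S C} {B : Str S D} {T : Str S E} (F : StrFunctor A B) (G : StrFunctor B T) :
    StrFunctor A T where
  toOpFunctor := F.toOpFunctor.comp G.toOpFunctor
  cell_comm c X := by
    have h1 := F.cell_comm c X
    have h2 := G.cell_comm c (fun i => F.functor.obj (X i))
    rw [OpFunctor.termIso_comp, OpFunctor.termIso_comp]
    exact (Category.assoc _ _ _).symm.trans ((congrArg (· ≫ _) h2).trans
      ((Category.assoc _ _ _).trans ((congrArg (_ ≫ ·)
        ((G.functor.map_comp _ _).symm.trans ((congrArg G.functor.map h1).trans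
          (G.functor.map_comp _ _)))).trans (Category.assoc _ _ _).symm)))

/-- A natural isomorphism of structure-preserving functors: a natural isomorphism of the
underlying functors compatible with the isomorphisms attached to the operations. -/
structure StrIso {S : StructType.{w₁, w₂}} {C : Type u} [Category.{v} C]
    {D : Type u'} [Category.{v'} D] {A : Str S C} {B : Str S D} (F G : StrFunctor A B) where
  iso : F.functor ≅ G.functor
  opIso_comm (o : S.Op) (X : Fin (S.arity o) → C) :
    (B.op o).map (X := fun i => F.functor.obj (X i)) (Y := fun i => G.functor.obj (X i))
        (fun i => iso.hom.app (X i)) ≫ (G.opIso o X).hom =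
      (F.opIso o X).hom ≫ iso.hom.app ((A.op o).obj X)

/-! ### Full subcategories closed under the operations -/

/-- The restriction of the operations to a full subcategory closed under them. -/
def OpStr.restrict {S : StructType.{w₁, w₂}} {C : Type u} [Category.{v} C]
    (A : OpStr S C) (Q : ObjectProperty C) (h : A.Closed Q) : OpStr S Q.FullSubcategory where
  op o := Q.lift (Functor.pi (fun _ : Fin (S.arity o) => Q.ι) ⋙ A.op o)
    (fun X => h o (fun i => (X i).obj) (fun i => (X i).property))

/-- The inclusion of the full subcategory commutes strictly with the operations. -/
def OpStr.inclusion {S : StructType.{w₁, w₂}} {C : Type u} [Category.{v} C]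
    (A : OpStr S C) (Q : ObjectProperty C) (h : A.Closed Q) :
    OpFunctor (A.restrict Q h) A where
  functor := Q.ι
  opIso _ _ := Iso.refl _
  opIso_natural o X Y f := by
    simp only [Iso.refl_hom]
    erw [Category.comp_id, Category.id_comp]
    rfl

theorem inv_square_comp {C : Type u} [Category.{v} C] {X X' Y Y' Z Z' W W' : C}
    {a : X ≅ Y} {a' : X' ≅ Y'} {b : Z ≅ W} {b' : Z' ≅ W'} {m : X ⟶ X'} {n : Y ⟶ Y'}
    {p : Z ⟶ Z'} {q : W ⟶ W'} {c : X ⟶ Z} {c' : X' ⟶ Z'} (h1 : m ≫ a'.hom = a.hom ≫ n)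
    (h3 : m ≫ c' = c ≫ p) (h2 : p ≫ b'.hom = b.hom ≫ q) :
    n ≫ (a'.inv ≫ c' ≫ b'.hom) = (a.inv ≫ c ≫ b.hom) ≫ q := by
  have h : n ≫ a'.inv = a.inv ≫ m := by
    rw [Iso.eq_inv_comp, ← Category.assoc, ← h1, Category.assoc, Iso.hom_inv_id, Category.comp_id]
  rw [← Category.assoc, h]
  simp only [Category.assoc]
  rw [← h2, ← Category.assoc m, h3, Category.assoc]

/-- The restriction of the structure to a full subcategory closed under the operations. -/
def Str.restrict {S : StructType.{w₁, w₂}} {C : Type u} [Category.{v} C]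
    (A : Str S C) (Q : ObjectProperty C) (h : A.Closed Q) : Str S Q.FullSubcategory where
  toOpStr := A.toOpStr.restrict Q h
  cell c :=
    { app := fun X => ObjectProperty.homMk
        (((A.inclusion Q h).termIso (S.src c) X).inv ≫
          (A.cell c).app (fun i => (X i).obj) ≫ ((A.inclusion Q h).termIso (S.tgt c) X).hom)
      naturality := fun X Y f => by
        ext
        have h1 := (A.inclusion Q h).termIso_natural (S.src c) X Y f
        have h2 := (A.inclusion Q h).termIso_natural (S.tgt c) X Y f
        have h3 := (A.cell c).naturality (X := fun i => (X i).obj) (Y := fun i => (Y i).obj)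
          (fun i => (f i).hom)
        exact inv_square_comp h1 h3 h2 }

/-- The inclusion of the full subcategory as a structure-preserving functor. -/
def Str.inclusion {S : StructType.{w₁, w₂}} {C : Type u} [Category.{v} C]
    (A : Str S C) (Q : ObjectProperty C) (h : A.Closed Q) :
    StrFunctor (A.restrict Q h) A where
  toOpFunctor := A.toOpStr.inclusion Q h
  cell_comm c X := by
    symm
    erw [Iso.hom_inv_id_assoc]
    rfl

/-! ### Abelian completions -/

/-- The structured abelian category `D`, with the functor `j : P ⥤ D`, is an abelian completion
(a reflection) of the structured preadditive category `P` in the category of those structured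
abelian categories `E` which satisfy `Φ`, where the morphisms are isomorphism classes of right exact
structure-preserving functors: every additive structure-preserving functor `P ⥤ E` extends along
`j` to a right exact structure-preserving functor `D ⥤ E`, and the extension is unique up to
structure-preserving natural isomorphism. -/
structure IsAbelianCompletion {S : StructType.{w₁, w₂}}
    (Φ : ∀ (E : Type uE) [Category.{vE} E] [Abelian E], Str S E → Prop)
    {P : Type uP} [Category.{vP} P] [Preadditive P] {A : Str S P}
    {D : Type u} [Category.{v} D] [Abelian D] {B : Str S D} (j : StrFunctor A B) : Prop where
  rightExact : B.RightExact
  additive : j.functor.Additive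
  exists_extension : ∀ (E : Type uE) [Category.{vE} E] [Abelian E] (T : Str S E),
    T.RightExact → Φ E T → ∀ F : StrFunctor A T, F.functor.Additive →
      ∃ G : StrFunctor B T, PreservesFiniteColimits G.functor ∧ Nonempty (StrIso (j.comp G) F)
  unique_extension : ∀ (E : Type uE) [Category.{vE} E] [Abelian E] (T : Str S E),
    T.RightExact → Φ E T → ∀ G H : StrFunctor B T,
      PreservesFiniteColimits G.functor → PreservesFiniteColimits H.functor →
      Nonempty (StrIso (j.comp G) (j.comp H)) → Nonempty (StrIso G H)

/-! ### Linear tensor structures without unit, and finite tensor categories -/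

inductive TensorOp : Type
  | tensor

inductive TensorCell (k : Type w₂) : Type w₂
  | assoc
  | scalar (r : k)

/-- The type of `k`-linear tensor structures without unit: one binary operation `⊗`, a natural
transformation `(x ⊗ y) ⊗ z ⟶ x ⊗ (y ⊗ z)` and, for every scalar, a natural transformation
`x ⟶ x`. -/
def tensorType (k : Type w₂) : StructType.{0, w₂} where
  Op := TensorOp
  arity _ := 2
  Cell := TensorCell k
  cellArity
    | .assoc => 3
    | .scalar _ => 1
  src
    | .assoc => .op .tensor ![.op .tensor ![.var 0, .var 1], .var 2]
    | .scalar _ => .var 0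
  tgt
    | .assoc => .op .tensor ![.var 0, .op .tensor ![.var 1, .var 2]]
    | .scalar _ => .var 0

section Tensor

variable (k : Type w₂) (C : Type u) [Category.{v} C] [MonoidalCategory C]

def tensorOpStr : OpStr (tensorType k) C where
  op _ :=
    { obj := fun X : Fin 2 → C => X 0 ⊗ X 1
      map := fun {X Y : Fin 2 → C} (f : X ⟶ Y) => f 0 ⊗ₘ f 1
      map_id := fun X : Fin 2 → C => id_tensorHom_id (X 0) (X 1)
      map_comp := fun {X Y Z : Fin 2 → C} (f : X ⟶ Y) (g : Y ⟶ Z) =>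
        (tensorHom_comp_tensorHom (f 0) (f 1) (g 0) (g 1)).symm }

/-- The underlying `k`-linear tensor structure without unit of a `k`-linear monoidal category. -/
def tensorStr [Field k] [Preadditive C] [Linear k C] : Str (tensorType k) C where
  toOpStr := tensorOpStr k C
  cell
    | .assoc =>
      { app := fun X : Fin 3 → C => (α_ (X (0 : Fin 3)) (X (1 : Fin 3)) (X (2 : Fin 3))).hom
        naturality := fun X Y (f : ∀ i : Fin 3, X i ⟶ Y i) =>
          associator_naturality (f (0 : Fin 3)) (f (1 : Fin 3)) (f (2 : Fin 3)) }
    | .scalar r =>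
      { app := fun X : Fin 1 → C => r • 𝟙 (X (0 : Fin 1))
        naturality := fun X Y (f : ∀ i : Fin 1, X i ⟶ Y i) =>
          (Linear.comp_smul _ _ _ (f (0 : Fin 1)) r (𝟙 (Y (0 : Fin 1)))).trans
            ((congrArg (r • ·) ((Category.comp_id _).trans (Category.id_comp _).symm)).trans
              (Linear.smul_comp _ _ _ r (𝟙 (X (0 : Fin 1))) (f (0 : Fin 1))).symm) }

theorem projective_tensor [RigidCategory C] (X Y : C) (hX : Projective X) :
    Projective (X ⊗ Y) := by
  have hl : (tensorRight (HasRightDual.rightDual Y)).IsLeftAdjoint :=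
    (tensorRightAdjunction (HasRightDual.rightDual Y)
      (HasRightDual.rightDual (HasRightDual.rightDual Y))).isLeftAdjoint
  exact (tensorRightAdjunction Y (HasRightDual.rightDual Y)).map_projective X hX

theorem tensorOpStr_closed [RigidCategory C] : (tensorOpStr k C).Closed (isProjective C) :=
  fun _ X h => projective_tensor C (X (0 : Fin 2)) (X (1 : Fin 2)) (h (0 : Fin 2))

/-- The `k`-linear tensor category without unit formed by the projective objects. -/
abbrev projTensorStr [Field k] [Preadditive C] [Linear k C] [RigidCategory C] :
    Str (tensorType k) (isProjective C).FullSubcategory :=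
  (tensorStr k C).restrict (isProjective C) (tensorOpStr_closed k C)

/-- The inclusion of the tensor category of projective objects. -/
abbrev projTensorInclusion [Field k] [Preadditive C] [Linear k C] [RigidCategory C] :
    StrFunctor (projTensorStr k C) (tensorStr k C) :=
  (tensorStr k C).inclusion (isProjective C) (tensorOpStr_closed k C)

variable {C} {D : Type u'} [Category.{v'} D] [MonoidalCategory D]

/-- A `k`-linear monoidal functor as a functor preserving the tensor structure without unit. -/
def monoidalStrFunctor [Field k] [Preadditive C] [Linear k C] [Preadditive D] [Linear k D]
    (F : C ⥤ D) [F.Monoidal] [F.Additive] [F.Linear k] :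
    StrFunctor (tensorStr k C) (tensorStr k D) where
  functor := F
  opIso _ X := Functor.Monoidal.μIso F (X (0 : Fin 2)) (X (1 : Fin 2))
  opIso_natural _ X Y f :=
    Functor.LaxMonoidal.μ_natural F (f (0 : Fin 2)) (f (1 : Fin 2))
  cell_comm
    | .assoc, X => by
        change (α_ (F.obj (X (0 : Fin 3))) (F.obj (X (1 : Fin 3))) (F.obj (X (2 : Fin 3)))).hom ≫
            ((𝟙 _ ⊗ₘ ((𝟙 _ ⊗ₘ 𝟙 _) ≫ Functor.LaxMonoidal.μ F _ _)) ≫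
              Functor.LaxMonoidal.μ F _ _) =
          ((((𝟙 _ ⊗ₘ 𝟙 _) ≫ Functor.LaxMonoidal.μ F _ _) ⊗ₘ 𝟙 _) ≫
            Functor.LaxMonoidal.μ F _ _) ≫ F.map (α_ _ _ _).hom
        simp
    | .scalar r, X => by
        change (r • 𝟙 (F.obj (X (0 : Fin 1)))) ≫ 𝟙 _ = 𝟙 _ ≫ F.map (r • 𝟙 (X (0 : Fin 1)))
        simp

end Tensor

/-- The finiteness and simplicity conditions by which a `k`-linear abelian rigid monoidal category
with bilinear tensor product is a finite tensor category: finite-dimensional morphism spaces,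
objects of finite length, enough projectives, finitely many simple objects up to isomorphism, and
`End(𝟙) = k`. -/
class IsFiniteTensorCategory (k : Type w₂) [Field k] (C : Type u) [Category.{v} C] [Abelian C]
    [Linear k C] [MonoidalCategory C] : Prop where
  finite_hom (X Y : C) : Module.Finite k (X ⟶ Y)
  artinian (X : C) : IsArtinianObject X
  noetherian (X : C) : IsNoetherianObject X
  enoughProjectives : EnoughProjectives C
  finite_simples : ∃ (n : ℕ) (L : Fin n → C), ∀ X : C, Simple X → ∃ i, Nonempty (X ≅ L i)
  end_unit : Module.finrank k (𝟙_ C ⟶ 𝟙_ C) = 1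

/-! ### Right exact functors of one variable -/

section RightExactFunctors

variable {C : Type u} [Category.{v} C] [Abelian C] {E : Type uE} [Category.{vE} E] [Abelian E]

/-! Every object `X` has a presentation `P₁ ⟶ P₀ ⟶ X ⟶ 0` by projectives, so a right exact functor
is forced on `X` by its values on projectives. Conversely, an additive functor on projectives
extends by taking cokernels (`extFunctor`). The real content is that the same holds for functors of
several variables and for the natural transformations between them, so that operations, cells and
coherence isomorphisms extend as well.

In several variables the replacement for a presentation is `SlotRightExact.exists_desc`. If `e : P ⟶
X` is componentwise epi and `T` is right exact in each variable, then a morphism out of `T P`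
descends to `T X` as soon as it kills `T δ` for every `δ` from a projective family such that some
component of `δ ≫ e` vanishes. This is proved by changing one slot at a time. A natural
transformation given on projective families respects these relations, since the target functor sends
a family of morphisms with a zero component to zero. Hence it extends (`exists_natTrans`), and an
isomorphism extends to an isomorphism (`exists_natIso`).

Uniqueness needs less: a natural transformation is determined on projectives once its source functor
preserves componentwise epimorphisms (`natTrans_ext_of_projective`). This weaker condition matters,
because a formal composite with repeated variables, such as `x ⊗ x`, need not be right exact in each
variable but still preserves such epimorphisms (`epi_eval_map`). The cell equations of an extended
functor therefore follow from those on projectives.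

Thus `C` has the universal property of a completion, and the two uniqueness statements follow by
comparing extensions in both directions. For finite tensor categories, rigidity makes the tensor
product right exact and projectives closed under it. The unit, usually not projective, is recovered
because an equivalence compatible with `⊗` and its associator carries a unit to a unit in a
compatible way (`exists_unitIso`, `isMonoidal_of_tensor`). -/

theorem additive_of_preservesFiniteColimits (G : C ⥤ E) [PreservesFiniteColimits G] :
    G.Additive := by
  have := preservesBinaryBiproducts_of_preservesBinaryCoproducts G
  exact Functor.additive_of_preservesBinaryBiproducts G

theorem exists_desc_of_preservesFiniteColimits (G : C ⥤ E) [PreservesFiniteColimits G]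
    {X Y : C} (g : X ⟶ Y) [Epi g] {Z : E} (φ : G.obj X ⟶ Z)
    (h : G.map (kernel.ι g) ≫ φ = 0) : ∃ ψ : G.obj Y ⟶ Z, G.map g ≫ ψ = φ := by
  have := additive_of_preservesFiniteColimits G
  have hS : (ShortComplex.mk (kernel.ι g) g (kernel.condition g)).Exact :=
    ShortComplex.exact_kernel g
  obtain ⟨h1, h2⟩ := ((Functor.preservesFiniteColimits_tfae G).out 3 1 :).1 inferInstance
    (ShortComplex.mk (kernel.ι g) g (kernel.condition g)) ⟨hS, inferInstance⟩
  have : Epi ((ShortComplex.mk (kernel.ι g) g (kernel.condition g)).map G).g := h2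
  exact ⟨h1.desc φ h, h1.g_desc φ h⟩

end RightExactFunctors

/-! ### Changing one variable of a family -/

section Slots

variable {C : Type u} [Category.{v} C] {E : Type uE} [Category.{vE} E] {n : ℕ}

/-- A functor of several variables which is right exact in each variable separately. -/
def SlotRightExact (T : (Fin n → C) ⥤ E) : Prop :=
  ∀ (X : Fin n → C) (i : Fin n), PreservesFiniteColimits (insertSlot X i ⋙ T)

/-- Change all slots other than `i` first, then slot `i` alone; the second step is in the image of
`insertSlot M i`, where one-variable right exactness applies. The isomorphism `w` is there because
`(insertSlot M i).obj (M i)` agrees with `M` only after evaluating an `if` in each slot. -/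
theorem exists_slot_factorization {R M : Fin n → C} (δ : R ⟶ M) (i : Fin n) :
    ∃ (a : R ⟶ (insertSlot M i).obj (R i)) (w : (insertSlot M i).obj (M i) ≅ M),
      δ = a ≫ (insertSlot M i).map (δ i) ≫ w.hom ∧ IsIso (a i) ∧
      ∀ j, j ≠ i → IsIso (δ j) → IsIso (a j) := by
  have key : ∀ j : Fin n, ∃ (a : R j ⟶ (if j = i then 𝟭 C else (Functor.const C).obj (M j)).obj (R i))
      (w : (if j = i then 𝟭 C else (Functor.const C).obj (M j)).obj (M i) ≅ M j),
      δ j = a ≫ (if j = i then 𝟭 C else (Functor.const C).obj (M j)).map (δ i) ≫ w.hom ∧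
      (j = i → IsIso a) ∧ (j ≠ i → IsIso (δ j) → IsIso a) := by
    intro j
    by_cases hj : j = i
    · rw [if_pos hj]
      subst hj
      exact ⟨𝟙 _, Iso.refl (M j), by simp, fun _ => inferInstance, fun _ _ => inferInstance⟩
    · rw [if_neg hj]
      exact ⟨δ j, Iso.refl (M j), by simp, fun h => (hj h).elim, fun _ h => h⟩
  choose a w h1 h2 h3 using key
  exact ⟨a, Pi.isoMk w, funext h1, h2 i rfl, h3⟩

theorem insertSlot_map_zero [HasZeroMorphisms C] (X : Fin n → C) (i : Fin n) {Y Z : C} :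
    (insertSlot X i).map (0 : Y ⟶ Z) i = 0 := by
  have key : ∀ j : Fin n, j = i →
      (if j = i then 𝟭 C else (Functor.const C).obj (X j)).map (0 : Y ⟶ Z) = 0 := by
    intro j hj
    rw [if_pos hj]
    rfl
  exact key i rfl

end Slots

/-! ### Functors right exact in each variable, and their natural transformations -/

section SeveralVariables

variable {C : Type u} [Category.{v} C] [Abelian C] {E : Type uE} [Category.{vE} E] [Abelian E]
  {n : ℕ}

namespace SlotRightExact

variable {T : (Fin n → C) ⥤ E} (hT : SlotRightExact T)

include hT

/-- `T.map δ` factors through the value at `0` of the functor obtained by freezing all slots but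
`i`, and that functor is right exact, hence additive. -/
theorem map_eq_zero {R M : Fin n → C} (δ : R ⟶ M) (i : Fin n) (h : δ i = 0) : T.map δ = 0 := by
  obtain ⟨a, w, hδ, -, -⟩ := exists_slot_factorization δ i
  have := hT M i
  have := additive_of_preservesFiniteColimits (insertSlot M i ⋙ T)
  have h0 : T.map ((insertSlot M i).map (0 : R i ⟶ M i)) = 0 := (insertSlot M i ⋙ T).map_zero _ _
  rw [hδ, h, T.map_comp, T.map_comp, h0, zero_comp, comp_zero]

omit [Abelian C] [Abelian E] in
theorem epi_map_of_isIso {R M : Fin n → C} (δ : R ⟶ M) (i : Fin n) [Epi (δ i)]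
    (h : ∀ j, j ≠ i → IsIso (δ j)) : Epi (T.map δ) := by
  obtain ⟨a, w, hδ, h1, h2⟩ := exists_slot_factorization δ i
  have := hT M i
  have ha : IsIso a := (isIso_pi_iff a).2 fun j => by
    by_cases hj : j = i
    · exact hj ▸ h1
    · exact h2 j hj (h j hj)
  have : Epi (T.map ((insertSlot M i).map (δ i))) :=
    inferInstanceAs (Epi ((insertSlot M i ⋙ T).map (δ i)))
  rw [hδ, T.map_comp, T.map_comp]
  infer_instance

end SlotRightExact

omit [Abelian C] in
-- The induction step for treating slots one by one: split off the change in slot `a`, leaving a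
-- change in the slots of `s`.
theorem exists_change_slot {X Y : Fin n → C} (f : X ⟶ Y) (s : Finset (Fin n)) (a : Fin n)
    (hf : ∀ j, Epi (f j)) (h : ∀ j, j ∉ insert a s → IsIso (f j)) :
    ∃ (M : Fin n → C) (g : X ⟶ M) (k : M ⟶ Y), g ≫ k = f ∧ (∀ j, Epi (g j)) ∧
      (∀ j, Epi (k j)) ∧ (∀ j, j ≠ a → IsIso (g j)) ∧ ∀ j, j ∉ s → IsIso (k j) := by
  have key : ∀ j, ∃ (M : C) (g : X j ⟶ M) (k : M ⟶ Y j), g ≫ k = f j ∧ Epi g ∧ Epi k ∧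
      (j ≠ a → IsIso g) ∧ (j ∉ s → IsIso k) := by
    intro j
    have := hf j
    by_cases hj : j = a
    · exact ⟨Y j, f j, 𝟙 _, by simp, inferInstance, inferInstance, fun h => (h hj).elim,
        fun _ => inferInstance⟩
    · exact ⟨X j, 𝟙 _, f j, by simp, inferInstance, inferInstance, fun _ => inferInstance,
        fun hs => h j (by simp [hj, hs])⟩
  choose M g k h1 h2 h3 h4 h5 using key
  exact ⟨M, g, k, funext h1, h2, h3, h4, h5⟩

omit [Abelian C] [Abelian E] in
-- Cover each component by a projective and cancel the image of the cover. Only preservation of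
-- componentwise epimorphisms is assumed, so that this applies to formal composites with repeated
-- variables.
theorem natTrans_ext_of_projective [EnoughProjectives C] {T T' : (Fin n → C) ⥤ E}
    (hT : ∀ {X Y : Fin n → C} (f : X ⟶ Y), (∀ j, Epi (f j)) → Epi (T.map f)) {α β : T ⟶ T'}
    (h : ∀ P : Fin n → C, (∀ j, Projective (P j)) → α.app P = β.app P) : α = β := by
  ext X
  let p : (fun j => Projective.over (X j)) ⟶ X := fun j => Projective.π (X j)
  have : Epi (T.map p) := hT p fun j => inferInstanceAs (Epi (Projective.π _))
  rw [← cancel_epi (T.map p), α.naturality, β.naturality, h _ fun j => inferInstance]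

namespace SlotRightExact

variable {T : (Fin n → C) ⥤ E} (hT : SlotRightExact T)

include hT

omit [Abelian C] [Abelian E] in
theorem epi_map_of_isIso_notMem (s : Finset (Fin n)) : ∀ {X Y : Fin n → C} (f : X ⟶ Y),
    (∀ j, Epi (f j)) → (∀ j, j ∉ s → IsIso (f j)) → Epi (T.map f) := by
  induction s using Finset.induction_on with
  | empty =>
    intro X Y f _ h
    have : IsIso f := (isIso_pi_iff f).2 fun j => h j (by simp)
    infer_instance
  | insert a s _ ih =>
    intro X Y f hf h
    obtain ⟨M, g, k, rfl, hg, hk, hg', hk'⟩ := exists_change_slot f s a hf h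
    have := hg a
    have := hT.epi_map_of_isIso g a hg'
    have := ih k hk hk'
    rw [T.map_comp]
    infer_instance

omit [Abelian C] [Abelian E] in
theorem epi_map {X Y : Fin n → C} (f : X ⟶ Y) (hf : ∀ j, Epi (f j)) : Epi (T.map f) :=
  hT.epi_map_of_isIso_notMem Finset.univ f hf fun j hj => (hj (Finset.mem_univ j)).elim

variable [EnoughProjectives C]

/-- With the other slots frozen this is ordinary right exactness: the relations are the image of the
kernel of `g i`. -/
theorem exists_desc_of_isIso {P M : Fin n → C} (g : P ⟶ M) (i : Fin n) [Epi (g i)]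
    (h : ∀ j, j ≠ i → IsIso (g j)) {Z : E} (φ : T.obj P ⟶ Z)
    (hφ : ∀ (R : Fin n → C) (_ : ∀ j, Projective (R j)) (δ : R ⟶ P), (δ ≫ g) i = 0 →
      T.map δ ≫ φ = 0) : ∃ ψ : T.obj M ⟶ Z, T.map g ≫ ψ = φ := by
  obtain ⟨a, w, hg, h1, h2⟩ := exists_slot_factorization g i
  have := hT M i
  have ha : IsIso a := (isIso_pi_iff a).2 fun j => by
    by_cases hj : j = i
    · exact hj ▸ h1
    · exact h2 j hj (h j hj)
  obtain ⟨ψ, hψ⟩ := exists_desc_of_preservesFiniteColimits (insertSlot M i ⋙ T) (g i)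
    (T.map (inv a) ≫ φ) (by
      -- The frozen slots of `M` need not be projective, so the whole family is covered, not just
      -- the kernel in slot `i`; `T` sends this cover to an epimorphism.
      let K := (insertSlot M i).obj (kernel (g i))
      let q : (fun j => Projective.over (K j)) ⟶ K := fun j => Projective.π (K j)
      have : Epi (T.map q) := hT.epi_map q fun j => inferInstanceAs (Epi (Projective.π (K j)))
      rw [← cancel_epi (T.map q), comp_zero]
      have := hφ _ (fun j => inferInstance) (q ≫ (insertSlot M i).map (kernel.ι (g i)) ≫ inv a) (by
        have hg' : inv a ≫ g = (insertSlot M i).map (g i) ≫ w.hom := by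
          rw [IsIso.inv_comp_eq]
          exact hg
        rw [Category.assoc, Category.assoc, hg', ← Functor.map_comp_assoc, kernel.condition]
        change q i ≫ (insertSlot M i).map 0 i ≫ w.hom i = 0
        rw [insertSlot_map_zero, zero_comp, comp_zero])
      simpa only [T.map_comp, Category.assoc, Functor.comp_map] using this)
  refine ⟨T.map w.inv ≫ ψ, ?_⟩
  have hψ' : T.map ((insertSlot M i).map (g i)) ≫ ψ = T.map (inv a) ≫ φ := hψ
  rw [(congrArg T.map hg :), T.map_comp, T.map_comp, Category.assoc, Category.assoc, ← T.map_comp_assoc w.hom,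
    Iso.hom_inv_id, T.map_id, Category.id_comp, hψ', ← T.map_comp_assoc, IsIso.hom_inv_id,
    T.map_id, Category.id_comp]

theorem exists_desc_of_isIso_notMem (s : Finset (Fin n)) : ∀ {P X : Fin n → C} (e : P ⟶ X),
    (∀ j, Epi (e j)) → (∀ j, j ∉ s → IsIso (e j)) → ∀ {Z : E} (φ : T.obj P ⟶ Z),
    (∀ (R : Fin n → C) (_ : ∀ j, Projective (R j)) (δ : R ⟶ P) (i : Fin n), (δ ≫ e) i = 0 →
      T.map δ ≫ φ = 0) → ∃ ψ : T.obj X ⟶ Z, T.map e ≫ ψ = φ := by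
  induction s using Finset.induction_on with
  | empty =>
    intro P X e _ h Z φ _
    have : IsIso e := (isIso_pi_iff e).2 fun j => h j (by simp)
    exact ⟨inv (T.map e) ≫ φ, by simp⟩
  | insert a s _ ih =>
    intro P X e he h Z φ hφ
    obtain ⟨M, g, k, rfl, hg, hk, hg', hk'⟩ := exists_change_slot e s a he h
    have := hg a
    obtain ⟨φ', rfl⟩ := hT.exists_desc_of_isIso g a hg' φ fun R hR δ hδ => hφ R hR δ a (by
      rw [← Category.assoc]
      change (δ ≫ g) a ≫ k a = 0
      rw [hδ, zero_comp])
    obtain ⟨ψ, rfl⟩ := ih k hk hk' φ' fun R hR δ i hδ => by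
      -- A relation for the remaining slots is a map into the intermediate family `M`. Projectivity
      -- of `R` lifts it to `P`, where the hypothesis on `φ` lives.
      let δ' : R ⟶ P := fun j => Projective.factorThru (δ j) (g j)
      have hδ' : δ' ≫ g = δ := funext fun j => Projective.factorThru_comp (δ j) (g j)
      have := hφ R hR δ' i (by rw [← Category.assoc, hδ', hδ])
      rwa [← T.map_comp_assoc, hδ'] at this
    exact ⟨ψ, by rw [T.map_comp, Category.assoc]⟩

/-- The value of `T` at a quotient of a family `P` is the quotient of `T P` by the images of all
morphisms from projective families having a component which vanishes in the quotient. -/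
theorem exists_desc {P X : Fin n → C} (e : P ⟶ X) (he : ∀ j, Epi (e j)) {Z : E} (φ : T.obj P ⟶ Z)
    (hφ : ∀ (R : Fin n → C) (_ : ∀ j, Projective (R j)) (δ : R ⟶ P) (i : Fin n), (δ ≫ e) i = 0 →
      T.map δ ≫ φ = 0) : ∃ ψ : T.obj X ⟶ Z, T.map e ≫ ψ = φ :=
  hT.exists_desc_of_isIso_notMem Finset.univ e he
    (fun j hj => (hj (Finset.mem_univ j)).elim) φ hφ

variable {T' : (Fin n → C) ⥤ E} (hT' : SlotRightExact T')

include hT'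

/-- A natural transformation between functors which are right exact in each variable is determined
by its restriction to projective objects, and every natural transformation of the restrictions
extends. -/
theorem exists_natTrans
    (θ : ∀ P : Fin n → C, (∀ j, Projective (P j)) → (T.obj P ⟶ T'.obj P))
    (hθ : ∀ (P Q : Fin n → C) (hP : ∀ j, Projective (P j)) (hQ : ∀ j, Projective (Q j))
      (f : P ⟶ Q), T.map f ≫ θ Q hQ = θ P hP ≫ T'.map f) :
    ∃ α : T ⟶ T', ∀ (P : Fin n → C) (hP : ∀ j, Projective (P j)), α.app P = θ P hP := by
  let O : (Fin n → C) → Fin n → C := fun X j => Projective.over (X j)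
  have hO : ∀ X j, Projective (O X j) := fun X j => inferInstanceAs (Projective (Projective.over _))
  let p : ∀ X, O X ⟶ X := fun X j => Projective.π (X j)
  have hp : ∀ X j, Epi (p X j) := fun X j => inferInstanceAs (Epi (Projective.π _))
  have hpT : ∀ X, Epi (T.map (p X)) := fun X => hT.epi_map (p X) (hp X)
  have key : ∀ X, ∃ ψ : T.obj X ⟶ T'.obj X, T.map (p X) ≫ ψ = θ (O X) (hO X) ≫ T'.map (p X) :=
    fun X => hT.exists_desc (p X) (hp X) _ fun R hR δ i hδ => by
      rw [← Category.assoc, hθ R (O X) hR (hO X), Category.assoc, ← T'.map_comp,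
        hT'.map_eq_zero _ i hδ, comp_zero]
  choose ψ hψ using key
  -- Compatibility with every map from a projective family, not only the chosen cover. It gives
  -- naturality of `ψ`, and agreement with `θ` by taking the identity.
  have main : ∀ (P : Fin n → C) (hP : ∀ j, Projective (P j)) (X : Fin n → C) (f : P ⟶ X),
      T.map f ≫ ψ X = θ P hP ≫ T'.map f := by
    intro P hP X f
    let f' : P ⟶ O X := fun j => Projective.factorThru (f j) (p X j)
    have hf' : f' ≫ p X = f := funext fun j => Projective.factorThru_comp (f j) (p X j)
    rw [← hf', T.map_comp, Category.assoc, hψ, ← Category.assoc, hθ P _ hP (hO X),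
      Category.assoc, T'.map_comp]
  refine ⟨{ app := ψ, naturality := fun X Y f => ?_ }, fun P hP => ?_⟩
  · rw [← cancel_epi (T.map (p X)), ← T.map_comp_assoc, main _ (hO X), ← Category.assoc, hψ,
      Category.assoc, T'.map_comp]
  · have := main P hP P (𝟙 P)
    rwa [T.map_id, T'.map_id, Category.id_comp, Category.comp_id] at this

/-- A natural isomorphism on projective objects between functors which are right exact in each
variable extends to a natural isomorphism. -/
theorem exists_natIso
    (θ : ∀ P : Fin n → C, (∀ j, Projective (P j)) → (T.obj P ≅ T'.obj P))
    (hθ : ∀ (P Q : Fin n → C) (hP : ∀ j, Projective (P j)) (hQ : ∀ j, Projective (Q j))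
      (f : P ⟶ Q), T.map f ≫ (θ Q hQ).hom = (θ P hP).hom ≫ T'.map f) :
    ∃ α : T ≅ T', ∀ (P : Fin n → C) (hP : ∀ j, Projective (P j)), α.hom.app P = (θ P hP).hom := by
  obtain ⟨α, hα⟩ := hT.exists_natTrans hT' (fun P hP => (θ P hP).hom) hθ
  obtain ⟨β, hβ⟩ := hT'.exists_natTrans hT (fun P hP => (θ P hP).inv) fun P Q hP hQ f => by
    rw [Iso.eq_inv_comp, ← Category.assoc, ← hθ P Q hP hQ, Category.assoc, Iso.hom_inv_id,
      Category.comp_id]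
  exact ⟨⟨α, β, natTrans_ext_of_projective hT.epi_map fun P hP => by simp [hα P hP, hβ P hP],
    natTrans_ext_of_projective hT'.epi_map fun P hP => by simp [hα P hP, hβ P hP]⟩, hα⟩

end SlotRightExact

end SeveralVariables

/-! ### Right exact extension of an additive functor on projectives -/

section Extension

variable {C : Type u} [Category.{v} C] [Abelian C] {E : Type uE} [Category.{vE} E] [Abelian E]

instance projective_of_isProjective (P : (isProjective C).FullSubcategory) : Projective P.obj :=
  P.property

variable [EnoughProjectives C]

/-- The chosen projective cover of `X`, as an object of the subcategory of projectives. -/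
noncomputable def coverObj (X : C) : (isProjective C).FullSubcategory :=
  ⟨Projective.over X, Projective.projective_over X⟩

/-- The epimorphism from the chosen projective cover. -/
noncomputable def coverπ (X : C) : (coverObj X).obj ⟶ X := Projective.π X

instance (X : C) : Epi (coverπ X) := Projective.π_epi X

/-- The first differential of the chosen projective presentation of `X`. -/
noncomputable def coverRel (X : C) : coverObj (kernel (coverπ X)) ⟶ coverObj X :=
  ObjectProperty.homMk (coverπ (kernel (coverπ X)) ≫ kernel.ι (coverπ X))

theorem coverRel_comp (X : C) : (coverRel X).hom ≫ coverπ X = 0 := by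
  change (coverπ (kernel (coverπ X)) ≫ kernel.ι (coverπ X)) ≫ coverπ X = 0
  rw [Category.assoc, kernel.condition, comp_zero]

theorem exists_comp_coverRel {X : C} {P : (isProjective C).FullSubcategory} (δ : P ⟶ coverObj X)
    (h : δ.hom ≫ coverπ X = 0) :
    ∃ q : P ⟶ coverObj (kernel (coverπ X)), q ≫ coverRel X = δ := by
  refine ⟨ObjectProperty.homMk (Projective.factorThru (kernel.lift _ δ.hom h)
    (coverπ (kernel (coverπ X)))), ?_⟩
  ext
  change Projective.factorThru _ _ ≫ coverπ (kernel (coverπ X)) ≫ kernel.ι _ = δ.hom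
  rw [Projective.factorThru_comp_assoc, kernel.lift_ι]

/-- A lift of a morphism from a projective object to the chosen projective cover. -/
noncomputable def coverLift {X : C} {P : (isProjective C).FullSubcategory} (p : P.obj ⟶ X) :
    P ⟶ coverObj X :=
  ObjectProperty.homMk (Projective.factorThru p (coverπ X))

omit [Abelian C] in
theorem coverLift_comp {X : C} {P : (isProjective C).FullSubcategory} (p : P.obj ⟶ X) :
    (coverLift p).hom ≫ coverπ X = p :=
  Projective.factorThru_comp p (coverπ X)

variable (F : (isProjective C).FullSubcategory ⥤ E)

/-- The cokernel of the image under `F` of the chosen projective presentation of `X`. -/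
noncomputable def extObj (X : C) : E := cokernel (F.map (coverRel X))

/-- The projection to the cokernel which defines `extObj F X`. -/
noncomputable def extπ (X : C) : F.obj (coverObj X) ⟶ extObj F X := cokernel.π (F.map (coverRel X))

instance (X : C) : Epi (extπ F X) := inferInstanceAs (Epi (cokernel.π _))

theorem map_coverRel_comp_extπ (X : C) : F.map (coverRel X) ≫ extπ F X = 0 := cokernel.condition _

theorem exists_extπ_desc {X : C} {Z : E} (φ : F.obj (coverObj X) ⟶ Z)
    (h : F.map (coverRel X) ≫ φ = 0) : ∃ ψ : extObj F X ⟶ Z, extπ F X ≫ ψ = φ :=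
  ⟨cokernel.desc _ φ h, cokernel.π_desc _ _ _⟩

/-- The canonical morphism attached to a morphism from a projective object to `X`. -/
noncomputable def extMk {X : C} {P : (isProjective C).FullSubcategory} (p : P.obj ⟶ X) :
    F.obj P ⟶ extObj F X :=
  F.map (coverLift p) ≫ extπ F X

variable [F.Additive]

/-- Two lifts of `p` to the cover differ by a map into the kernel, which factors through `coverRel
X`; additivity of `F` makes the difference vanish in the cokernel. So `extMk` is independent of the
lift. -/
theorem map_comp_extπ {X : C} {P : (isProjective C).FullSubcategory} {p : P.obj ⟶ X}
    (a : P ⟶ coverObj X) (ha : a.hom ≫ coverπ X = p) :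
    F.map a ≫ extπ F X = extMk F p := by
  obtain ⟨q, hq⟩ := exists_comp_coverRel (a - coverLift p) (by
    change (a.hom - (coverLift p).hom) ≫ _ = 0
    rw [Preadditive.sub_comp, ha, coverLift_comp, sub_self])
  rw [extMk, ← sub_eq_zero, ← Preadditive.sub_comp, ← F.map_sub, ← hq, F.map_comp, Category.assoc,
    map_coverRel_comp_extπ, comp_zero]

theorem map_comp_extMk {X : C} {P Q : (isProjective C).FullSubcategory} (f : P ⟶ Q)
    (p : Q.obj ⟶ X) : F.map f ≫ extMk F p = extMk F (f.hom ≫ p) := by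
  rw [← map_comp_extπ F (f ≫ coverLift p)
    (by rw [ObjectProperty.FullSubcategory.comp_hom, Category.assoc, coverLift_comp]),
    F.map_comp, Category.assoc, extMk]

theorem extMk_π (X : C) :
    extMk F (coverπ X) = extπ F X := by
  rw [← map_comp_extπ F (𝟙 (coverObj X)) (Category.id_comp _), F.map_id, Category.id_comp]

theorem epi_extMk {X : C} {P : (isProjective C).FullSubcategory} (p : P.obj ⟶ X) [Epi p] :
    Epi (extMk F p) := by
  let b : coverObj X ⟶ P := ObjectProperty.homMk (Projective.factorThru (coverπ X) p)
  have hb : F.map b ≫ extMk F p = extπ F X := by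
    rw [map_comp_extMk, ← extMk_π]
    congr 1
    exact Projective.factorThru_comp _ _
  have : Epi (F.map b ≫ extMk F p) := by
    rw [hb]
    infer_instance
  exact epi_of_epi (F.map b) _

omit [EnoughProjectives C] in
theorem map_comp_eq {X : C} {P Q : (isProjective C).FullSubcategory} (p : P.obj ⟶ X) {Z : E}
    (φ : F.obj P ⟶ Z)
    (hφ : ∀ (R : (isProjective C).FullSubcategory) (δ : R ⟶ P), δ.hom ≫ p = 0 → F.map δ ≫ φ = 0)
    (f g : Q ⟶ P) (h : f.hom ≫ p = g.hom ≫ p) : F.map f ≫ φ = F.map g ≫ φ := by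
  rw [← sub_eq_zero, ← Preadditive.sub_comp, ← F.map_sub]
  refine hφ _ _ ?_
  change (f.hom - g.hom) ≫ p = 0
  rw [Preadditive.sub_comp, h, sub_self]

/-- Frees `extObj` from the chosen cover: any epimorphism from a projective presents it, since
covers map to each other over `X`. Together with `epi_extMk` this is its universal property. -/
theorem exists_extMk_desc {X : C} {P : (isProjective C).FullSubcategory} (p : P.obj ⟶ X) [Epi p]
    {Z : E} (φ : F.obj P ⟶ Z)
    (hφ : ∀ (R : (isProjective C).FullSubcategory) (δ : R ⟶ P), δ.hom ≫ p = 0 →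
      F.map δ ≫ φ = 0) : ∃ ψ : extObj F X ⟶ Z, extMk F p ≫ ψ = φ := by
  let b : coverObj X ⟶ P := ObjectProperty.homMk (Projective.factorThru (coverπ X) p)
  have hb : b.hom ≫ p = coverπ X := Projective.factorThru_comp _ _
  obtain ⟨ψ, hψ⟩ := exists_extπ_desc F (F.map b ≫ φ) (by
    rw [← F.map_comp_assoc]
    refine hφ _ _ ?_
    rw [ObjectProperty.FullSubcategory.comp_hom, Category.assoc, hb, coverRel_comp])
  refine ⟨ψ, ?_⟩
  · rw [extMk, Category.assoc, hψ, ← F.map_comp_assoc,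
      map_comp_eq F p φ hφ (coverLift p ≫ b) (𝟙 P), F.map_id, Category.id_comp]
    rw [ObjectProperty.FullSubcategory.comp_hom, Category.assoc, hb, coverLift_comp]
    exact (Category.id_comp p).symm

theorem extMk_comp_eq_zero {X : C} {P R : (isProjective C).FullSubcategory} (p : P.obj ⟶ X)
    (δ : R ⟶ P) (h : δ.hom ≫ p = 0) : F.map δ ≫ extMk F p = 0 := by
  rw [map_comp_extMk, h, ← map_comp_extπ F (0 : R ⟶ coverObj X) zero_comp, F.map_zero,
    zero_comp]

theorem exists_extMap {X Y : C} (f : X ⟶ Y) : ∃ g : extObj F X ⟶ extObj F Y,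
    extMk F (coverπ X) ≫ g =
      extMk F (coverπ X ≫ f) := by
  refine exists_extMk_desc F (coverπ X) _ fun R δ hδ =>
    extMk_comp_eq_zero F (P := coverObj X) _ δ ?_
  rw [← Category.assoc, hδ, zero_comp]

/-- The action on morphisms of the right exact extension of `F`. -/
noncomputable def extMap {X Y : C} (f : X ⟶ Y) : extObj F X ⟶ extObj F Y :=
  (exists_extMap F f).choose

theorem extMk_comp_extMap {X Y : C} {P : (isProjective C).FullSubcategory} (p : P.obj ⟶ X)
    (f : X ⟶ Y) : extMk F p ≫ extMap F f = extMk F (p ≫ f) := by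
  have h := (exists_extMap F f).choose_spec
  change _ ≫ extMap F f = _ at h
  have hp := coverLift_comp p
  have h1 := map_comp_extMk F (coverLift p) (coverπ X)
  rw [hp] at h1
  rw [← h1, Category.assoc, h, map_comp_extMk, ← Category.assoc, hp]

theorem extObj_hom_ext {X : C} {Z : E} {f g : extObj F X ⟶ Z}
    (h : ∀ (P : (isProjective C).FullSubcategory) (p : P.obj ⟶ X),
      extMk F p ≫ f = extMk F p ≫ g) : f = g := by
  have := epi_extMk F (coverπ X)
  exact (cancel_epi _).1 (h (coverObj X) (coverπ X))

/-- The right exact extension of an additive functor defined on projective objects. -/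
noncomputable def extFunctor : C ⥤ E where
  obj X := extObj F X
  map f := extMap F f
  map_id X := extObj_hom_ext F fun P p => by
    rw [extMk_comp_extMap, Category.comp_id, Category.comp_id]
  map_comp f g := extObj_hom_ext F fun P p => by
    rw [extMk_comp_extMap, ← Category.assoc (extMk F p), extMk_comp_extMap, extMk_comp_extMap,
      Category.assoc]

theorem extMk_add {X : C} {P : (isProjective C).FullSubcategory} (p q : P.obj ⟶ X) :
    extMk F (p + q) = extMk F p + extMk F q := by
  rw [← map_comp_extπ F (coverLift p + coverLift q), F.map_add, Preadditive.add_comp,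
    extMk, extMk]
  change ((coverLift p).hom + (coverLift q).hom) ≫ _ = _
  rw [Preadditive.add_comp, coverLift_comp, coverLift_comp]

instance extFunctor_additive : (extFunctor F).Additive where
  map_add {X Y f g} := extObj_hom_ext F fun P p => by
    change _ ≫ extMap F (f + g) = _ ≫ (extMap F f + extMap F g)
    rw [extMk_comp_extMap, Preadditive.comp_add, Preadditive.comp_add, extMk_comp_extMap,
      extMk_comp_extMap, extMk_add]

instance extFunctor_preservesFiniteColimits : PreservesFiniteColimits (extFunctor F) := by
  refine ((Functor.preservesFiniteColimits_tfae (extFunctor F)).out 0 3 :).1 fun S hS => ?_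
  have := hS.epi_g
  let P := coverObj S.X₂
  let p : P.obj ⟶ S.X₂ := coverπ S.X₂
  have : Epi p := inferInstanceAs (Epi (coverπ S.X₂))
  have hg : extMk F p ≫ extMap F S.g = extMk F (p ≫ S.g) := extMk_comp_extMap F p S.g
  have h1 := epi_extMk F p
  have h2 := epi_extMk F (p ≫ S.g)
  have h3 : Epi (extMap F S.g) := by
    have : Epi (extMk F p ≫ extMap F S.g) := by rwa [hg]
    exact epi_of_epi (extMk F p) _
  refine ⟨?_, h3⟩
  have h4 : Epi (S.map (extFunctor F)).g := h3
  refine (S.map (extFunctor F)).exact_of_g_is_cokernel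
    (CokernelCofork.IsColimit.ofπ' _ _ fun {Z} (ψ : extObj F S.X₂ ⟶ Z) hψ => Classical.indefiniteDescription _ ?_)
  obtain ⟨χ, hχ⟩ := exists_extMk_desc F (p ≫ S.g) (extMk F p ≫ ψ) fun R δ hδ => by
    have hδ' : (δ.hom ≫ p) ≫ S.g = 0 := by rw [Category.assoc, hδ]
    have := hS.mono_f
    have hl : hS.exact.lift (δ.hom ≫ p) hδ' ≫ S.f = δ.hom ≫ p := hS.exact.lift_f _ _
    have hψ' : extMap F S.f ≫ ψ = 0 := hψ
    rw [← Category.assoc, map_comp_extMk, ← hl, ← extMk_comp_extMap, Category.assoc, hψ', comp_zero]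
  refine ⟨χ, ?_⟩
  change extMap F S.g ≫ χ = ψ
  rw [← cancel_epi (extMk F p), ← hχ, ← hg, Category.assoc]

/-- A projective object presents itself with no relations. -/
theorem isIso_extMk_id (P : (isProjective C).FullSubcategory) : IsIso (extMk F (𝟙 P.obj)) := by
  have := epi_extMk F (𝟙 P.obj)
  obtain ⟨ψ, hψ⟩ := exists_extMk_desc F (𝟙 P.obj) (𝟙 (F.obj P)) fun R δ hδ => by
    rw [Category.comp_id] at hδ
    have : δ = 0 := by
      ext
      exact hδ
    rw [this, F.map_zero, zero_comp]
  exact ⟨ψ, hψ, by rw [← cancel_epi (extMk F (𝟙 P.obj)), ← Category.assoc, hψ, Category.id_comp,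
    Category.comp_id]⟩

/-- The extension of `F` restricts to `F`. -/
noncomputable def extFunctorIso : (isProjective C).ι ⋙ extFunctor F ≅ F :=
  (NatIso.ofComponents (fun P => @asIso _ _ _ _ (extMk F (𝟙 P.obj)) (isIso_extMk_id F P))
    fun {P Q} f => by
      change F.map f ≫ extMk F (𝟙 Q.obj) = extMk F (𝟙 P.obj) ≫ extMap F f.hom
      rw [map_comp_extMk, extMk_comp_extMap, Category.comp_id, Category.id_comp]).symm

end Extension

/-! ### Composing with right exact functors -/

section SlotRightExactComp

variable {C : Type u} [Category.{v} C] {D : Type u'} [Category.{v'} D]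
  {E : Type uE} [Category.{vE} E] {n : ℕ}

theorem SlotRightExact.comp {T : (Fin n → C) ⥤ D} (hT : SlotRightExact T) (G : D ⥤ E)
    [PreservesFiniteColimits G] : SlotRightExact (T ⋙ G) := fun X i =>
  have := hT X i
  inferInstanceAs (PreservesFiniteColimits ((insertSlot X i ⋙ T) ⋙ G))

theorem insertSlot_comp_pi (G : C ⥤ D) (X : Fin n → C) (i : Fin n) :
    Nonempty (insertSlot X i ⋙ Functor.pi (fun _ => G) ≅
      G ⋙ insertSlot (fun j => G.obj (X j)) i) := by
  have key : ∀ j : Fin n, Nonempty ((if j = i then 𝟭 C else (Functor.const C).obj (X j)) ⋙ G ≅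
      G ⋙ (if j = i then 𝟭 D else (Functor.const D).obj (G.obj (X j)))) := by
    intro j
    by_cases hj : j = i
    · rw [if_pos hj, if_pos hj]
      exact ⟨Iso.refl _⟩
    · rw [if_neg hj, if_neg hj]
      exact ⟨NatIso.ofComponents (fun _ => Iso.refl (G.obj (X j))) fun f => by simp⟩
  let e := fun j => (key j).some
  exact ⟨NatIso.ofComponents (fun Y => Pi.isoMk fun j => (e j).app Y)
    (by intro _ _ f; exact funext fun j => (e j).hom.naturality f)⟩

theorem SlotRightExact.precomp {T : (Fin n → D) ⥤ E} (hT : SlotRightExact T) (G : C ⥤ D)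
    [PreservesFiniteColimits G] : SlotRightExact (Functor.pi (fun _ => G) ⋙ T) := fun X i => by
  obtain ⟨e⟩ := insertSlot_comp_pi G X i
  have := hT (fun j => G.obj (X j)) i
  have : PreservesFiniteColimits ((G ⋙ insertSlot (fun j => G.obj (X j)) i) ⋙ T) :=
    inferInstanceAs (PreservesFiniteColimits (G ⋙ insertSlot (fun j => G.obj (X j)) i ⋙ T))
  exact preservesFiniteColimits_of_natIso (Functor.isoWhiskerRight e.symm T)

end SlotRightExactComp

/-! ### One variable as a special case of several -/

section OneVariable

variable {C : Type u} [Category.{v} C] [Abelian C] [EnoughProjectives C]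
  {E : Type uE} [Category.{vE} E] [Abelian E]

omit [Abelian C] [EnoughProjectives C] [Abelian E] in
theorem slotRightExact_eval_comp (G : C ⥤ E) [PreservesFiniteColimits G] :
    SlotRightExact (Pi.eval (fun _ : Fin 1 => C) 0 ⋙ G) := fun X i => by
  obtain rfl : i = 0 := Subsingleton.elim _ _
  have e : insertSlot X 0 ⋙ Pi.eval (fun _ : Fin 1 => C) 0 ≅ 𝟭 C := eqToIso (by
    change (if (0 : Fin 1) = 0 then 𝟭 C else (Functor.const C).obj (X 0)) = 𝟭 C
    rw [if_pos rfl])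
  exact preservesFiniteColimits_of_natIso (Functor.isoWhiskerRight e.symm G)

/-- Right exact functors which are isomorphic on projective objects are isomorphic. -/
theorem exists_iso_of_restriction_iso (G H : C ⥤ E) [PreservesFiniteColimits G]
    [PreservesFiniteColimits H] (e : (isProjective C).ι ⋙ G ≅ (isProjective C).ι ⋙ H) :
    ∃ α : G ≅ H, ∀ P : (isProjective C).FullSubcategory, α.hom.app P.obj = e.hom.app P := by
  obtain ⟨α, hα⟩ := (slotRightExact_eval_comp G).exists_natIso (slotRightExact_eval_comp H)
    (fun P hP => e.app ⟨P 0, hP 0⟩) fun P Q hP hQ f =>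
      e.hom.naturality (X := ⟨P 0, hP 0⟩) (Y := ⟨Q 0, hQ 0⟩) (ObjectProperty.homMk (f 0))
  exact ⟨NatIso.ofComponents (fun X => α.app fun _ => X)
    fun f => α.hom.naturality (X := fun _ => _) (Y := fun _ => _) fun _ => f,
    fun P => hα (fun _ => P.obj) fun _ => P.property⟩

end OneVariable

/-! ### Operations, formal composites and cells as natural transformations -/

section OpFunctors

variable {S : StructType.{w₁, w₂}} {C : Type u} [Category.{v} C] {D : Type u'} [Category.{v'} D]
  {E : Type uE} [Category.{vE} E]

/-- The compatibility of a functor with an operation as a natural isomorphism. -/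
def OpFunctor.opNatIso {A : OpStr S C} {B : OpStr S D} (F : OpFunctor A B) (o : S.Op) :
    Functor.pi (fun _ => F.functor) ⋙ B.op o ≅ A.op o ⋙ F.functor :=
  NatIso.ofComponents (F.opIso o) fun {X Y} f => F.opIso_natural o X Y f

/-- The compatibility of a functor with a composite of operations as a natural transformation. -/
def OpFunctor.termNatTrans {A : OpStr S C} {B : OpStr S D} (F : OpFunctor A B) {n : ℕ}
    (t : StructTerm S.arity n) :
    Functor.pi (fun _ => F.functor) ⋙ B.eval t ⟶ A.eval t ⋙ F.functor where
  app X := (F.termIso t X).hom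
  naturality X Y f := F.termIso_natural t X Y f

/-- A functor commuting with the operations, given by natural isomorphisms. -/
def OpFunctor.ofNatIso {A : OpStr S C} {B : OpStr S D} (G : C ⥤ D)
    (α : ∀ o, Functor.pi (fun _ => G) ⋙ B.op o ≅ A.op o ⋙ G) : OpFunctor A B where
  functor := G
  opIso o X := (α o).app X
  opIso_natural o _ _ f := (α o).hom.naturality f

/-- Unlike right exactness in each variable, this property survives repetition of variables, so
induction on the term works. -/
theorem OpStr.RightExact.epi_eval_map {A : OpStr S C} (hA : A.RightExact) {n : ℕ}
    (t : StructTerm S.arity n) {X Y : Fin n → C} (f : X ⟶ Y) (hf : ∀ j, Epi (f j)) :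
    Epi ((A.eval t).map f) := by
  induction t with
  | var i => exact hf i
  | op o args ih =>
    exact SlotRightExact.epi_map (hA o) (X := fun j => (A.eval (args j)).obj X)
      (Y := fun j => (A.eval (args j)).obj Y) (fun j => (A.eval (args j)).map f) ih

/-- A natural transformation compatible with the operations is compatible with their composites. -/
theorem OpFunctor.termIso_comm {A : OpStr S C} {B : OpStr S D} {F G : OpFunctor A B}
    (α : F.functor ⟶ G.functor)
    (hα : ∀ (o : S.Op) (X : Fin (S.arity o) → C),
      (B.op o).map (X := fun i => F.functor.obj (X i)) (Y := fun i => G.functor.obj (X i))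
        (fun i => α.app (X i)) ≫ (G.opIso o X).hom =
      (F.opIso o X).hom ≫ α.app ((A.op o).obj X)) {n : ℕ}
    (t : StructTerm S.arity n) (X : Fin n → C) :
    (B.eval t).map (X := fun i => F.functor.obj (X i)) (Y := fun i => G.functor.obj (X i))
        (fun i => α.app (X i)) ≫ (G.termIso t X).hom =
      (F.termIso t X).hom ≫ α.app ((A.eval t).obj X) := by
  induction t with
  | var i => exact (Category.comp_id _).trans (Category.id_comp _).symm
  | op o args ih =>
    exact map_square_comp (B.op o) (X' := fun j => (B.eval (args j)).obj _)
      (p' := fun j => (G.termIso (args j) X).hom) (p := fun j => (F.termIso (args j) X).hom)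
      (funext ih) (hα o fun j => (A.eval (args j)).obj X)

/-- Five faces of a cube commute, hence so does the sixth, by cancelling `ed`. -/
theorem conjugate_square {a b c d a' b' c' d' : D} {m : a ⟶ b} {n : b ⟶ d} {p : a ⟶ c}
    {q : c ⟶ d} {m' : a' ⟶ b'} {n' : b' ⟶ d'} {p' : a' ⟶ c'} {q' : c' ⟶ d'}
    {ea : a ⟶ a'} {eb : b ⟶ b'} {ec : c ⟶ c'} {ed : d ⟶ d'} [Mono ed]
    (hm : m ≫ eb = ea ≫ m') (hn : n ≫ ed = eb ≫ n') (hp : p ≫ ec = ea ≫ p')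
    (hq : q ≫ ed = ec ≫ q') (h : m' ≫ n' = p' ≫ q') : m ≫ n = p ≫ q := by
  rw [← cancel_mono ed, Category.assoc, hn, ← Category.assoc, hm, Category.assoc, h,
    Category.assoc, hq, ← Category.assoc p, hp, Category.assoc]

theorem comp_square₃ {a b c d a' b' c' d' : D} {m : a ⟶ b} {n : b ⟶ c} {p : c ⟶ d}
    {m' : a' ⟶ b'} {n' : b' ⟶ c'} {p' : c' ⟶ d'} {f : a ⟶ a'} {g : b ⟶ b'} {h : c ⟶ c'}
    {k : d ⟶ d'} (hm : f ≫ m' = m ≫ g) (hn : g ≫ n' = n ≫ h) (hp : h ≫ p' = p ≫ k) :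
    f ≫ m' ≫ n' ≫ p' = (m ≫ n ≫ p) ≫ k := by
  rw [← Category.assoc, hm, Category.assoc, ← Category.assoc g, hn, Category.assoc, hp,
    Category.assoc, Category.assoc]

theorem comp_eq_of_eq_comp_inv {a b c d : D} {m : a ⟶ b} {n : b ⟶ c} (i : d ≅ c) {x : a ⟶ d}
    {y : d ⟶ d} (hy : y = 𝟙 d) (hx : x = m ≫ n ≫ i.inv) : m ≫ n = (x ≫ y) ≫ i.hom := by
  simp [hx, hy]

theorem comp_eq_of_comp_id {a b c d : D} {m m' : a ⟶ b} {n : b ⟶ c} {p : a ⟶ d} {q q' : d ⟶ c}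
    {y : d ⟶ d} {z : c ⟶ c} (hm : m = m') (hy : y = 𝟙 d) (hz : z = 𝟙 c) (hq : q = q')
    (h : m' ≫ n ≫ z = (p ≫ y) ≫ q') : m ≫ n = p ≫ q := by
  rw [hz, Category.comp_id, hy, Category.comp_id] at h
  rw [hm, hq, h]

/-- The compatibility with the cells passes along natural isomorphisms. -/
theorem OpFunctor.cell_comm_of_iso {A : Str S C} {B : Str S D}
    {F : OpFunctor A.toOpStr B.toOpStr} (G : StrFunctor A B) (α : F.functor ≅ G.functor)
    (hα : ∀ (o : S.Op) (X : Fin (S.arity o) → C),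
      (B.op o).map (X := fun i => F.functor.obj (X i)) (Y := fun i => G.functor.obj (X i))
        (fun i => α.hom.app (X i)) ≫ (G.opIso o X).hom =
      (F.opIso o X).hom ≫ α.hom.app ((A.op o).obj X)) (c : S.Cell)
    (X : Fin (S.cellArity c) → C) :
    (B.cell c).app (fun i => F.functor.obj (X i)) ≫ (F.termIso (S.tgt c) X).hom =
      (F.termIso (S.src c) X).hom ≫ F.functor.map ((A.cell c).app X) :=
  conjugate_square ((B.cell c).naturality (X := fun i => F.functor.obj (X i))
      (Y := fun i => G.functor.obj (X i)) fun i => α.hom.app (X i)).symm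
    (OpFunctor.termIso_comm (F := F) α.hom hα (S.tgt c) X).symm
    (OpFunctor.termIso_comm (F := F) α.hom hα (S.src c) X).symm (α.hom.naturality _)
    (G.cell_comm c X)

end OpFunctors

/-! ### Extending structure-preserving functors and isomorphisms from projectives -/

section Completion

variable {S : StructType.{w₁, w₂}} {C : Type u} [Category.{v} C] [Abelian C]
  [EnoughProjectives C] {A : Str S C} (hA : A.RightExact) (hP : A.Closed (isProjective C))
  {E : Type uE} [Category.{vE} E] [Abelian E] {T : Str S E} (hT : T.RightExact)

omit [Abelian C] [EnoughProjectives C] [Abelian E] in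
theorem comp_inclusion_cell_comm (G : OpFunctor A.toOpStr T.toOpStr) (c : S.Cell)
    (X : Fin (S.cellArity c) → (isProjective C).FullSubcategory)
    (h : (T.cell c).app (fun i => G.functor.obj (X i).obj) ≫
        (((A.toOpStr.inclusion _ hP).comp G).termIso (S.tgt c) X).hom =
      (((A.toOpStr.inclusion _ hP).comp G).termIso (S.src c) X).hom ≫
        G.functor.map ((((A.restrict _ hP).cell c).app X).hom)) :
    (T.cell c).app (fun i => G.functor.obj (X i).obj) ≫
        (G.termIso (S.tgt c) fun i => (X i).obj).hom =
      (G.termIso (S.src c) fun i => (X i).obj).hom ≫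
        G.functor.map ((A.cell c).app fun i => (X i).obj) := by
  rw [OpFunctor.termIso_comp, OpFunctor.termIso_comp] at h
  have h2 := congrArg G.functor.map ((A.inclusion _ hP).cell_comm c X)
  rw [Functor.map_comp, Functor.map_comp] at h2
  have : Mono (G.functor.map ((A.toOpStr.inclusion _ hP).termIso (S.tgt c) X).hom) := inferInstance
  refine (cancel_mono (G.functor.map ((A.toOpStr.inclusion _ hP).termIso (S.tgt c) X).hom)).1 ?_
  exact (Category.assoc _ _ _).trans (h.trans ((Category.assoc _ _ _).trans
    ((congrArg (_ ≫ ·) h2.symm).trans (Category.assoc _ _ _).symm)))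

include hA hT

/-- Existence of the right exact extension of a structure-preserving functor. -/
theorem exists_strFunctor_extension (F : StrFunctor (A.restrict (isProjective C) hP) T)
    [F.functor.Additive] :
    ∃ G : StrFunctor A T, PreservesFiniteColimits G.functor ∧
      Nonempty (StrIso ((A.inclusion (isProjective C) hP).comp G) F) := by
  let G := extFunctor F.functor
  let e : (isProjective C).ι ⋙ G ≅ F.functor := extFunctorIso F.functor
  let R := A.restrict (isProjective C) hP
  -- On projectives the constraint is that of `F` conjugated by `e`. Both sides are right exact in
  -- each variable, so it extends to all families.
  have hθ (o : S.Op) : ∃ α : Functor.pi (fun _ => G) ⋙ T.op o ≅ A.op o ⋙ G,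
      ∀ (P : Fin (S.arity o) → C) (hP : ∀ j, Projective (P j)), α.hom.app P =
        (T.op o).map (X := fun j => G.obj (P j))
          (fun j => e.hom.app (⟨P j, hP j⟩ : (isProjective C).FullSubcategory)) ≫
        (F.opIso o fun j => ⟨P j, hP j⟩).hom ≫ e.inv.app ((R.op o).obj fun j => ⟨P j, hP j⟩) :=
    SlotRightExact.exists_natIso (SlotRightExact.precomp (hT o) G) (SlotRightExact.comp (hA o) G)
      (fun P hP => (T.op o).mapIso (Pi.isoMk (fun j => e.app ⟨P j, hP j⟩)) ≪≫
        (F.opIso o fun j => ⟨P j, hP j⟩) ≪≫ (e.app ((R.op o).obj fun j => ⟨P j, hP j⟩)).symm)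
      fun P Q hP hQ f => comp_square₃
        (((T.op o).map_comp _ _).symm.trans ((congrArg (T.op o).map (funext fun j =>
          e.hom.naturality (X := ⟨P j, hP j⟩) (Y := ⟨Q j, hQ j⟩)
            (ObjectProperty.homMk (f j)))).trans ((T.op o).map_comp _ _)))
        (F.opIso_natural o (fun j => ⟨P j, hP j⟩) (fun j => ⟨Q j, hQ j⟩)
          fun j => ObjectProperty.homMk (f j))
        (e.inv.naturality ((R.op o).map (X := fun j => ⟨P j, hP j⟩) (Y := fun j => ⟨Q j, hQ j⟩)
          fun j => ObjectProperty.homMk (f j)))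
  choose α hα using hθ
  let G' : OpFunctor A.toOpStr T.toOpStr := OpFunctor.ofNatIso G α
  have he : ∀ (o : S.Op) (X : Fin (S.arity o) → (isProjective C).FullSubcategory),
      (T.op o).map (X := fun i => G.obj (X i).obj) (Y := fun i => F.functor.obj (X i))
        (fun i => e.hom.app (X i)) ≫ (F.opIso o X).hom =
      (((A.toOpStr.inclusion _ hP).comp G').opIso o X).hom ≫ e.hom.app ((R.op o).obj X) := fun o X =>
    comp_eq_of_eq_comp_inv (e.app ((R.op o).obj X)) (G.map_id _)
      (hα o (fun i => (X i).obj) fun i => (X i).property)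
  -- Both sides are natural in `X` and start from a functor preserving componentwise epimorphisms,
  -- so projective families suffice; there the equation is transported from `F` along `e`.
  have hcell : ∀ (c : S.Cell) (X : Fin (S.cellArity c) → C),
      (T.cell c).app (fun i => G.obj (X i)) ≫ (G'.termIso (S.tgt c) X).hom =
        (G'.termIso (S.src c) X).hom ≫ G.map ((A.cell c).app X) := fun c X =>
    congrArg (fun β => NatTrans.app β X) (natTrans_ext_of_projective
      (T := Functor.pi (fun _ => G) ⋙ T.eval (S.src c)) (T' := A.eval (S.tgt c) ⋙ G)
      (α := Functor.whiskerLeft (Functor.pi fun _ => G) (T.cell c) ≫ G'.termNatTrans (S.tgt c))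
      (β := G'.termNatTrans (S.src c) ≫ Functor.whiskerRight (A.cell c) G)
      (fun {X Y} f hf => hT.epi_eval_map _ (X := fun i => G.obj (X i)) (Y := fun i => G.obj (Y i))
        (fun i => G.map (f i)) fun i => inferInstance)
      fun P hP' => comp_inclusion_cell_comm hP G' c (fun i => ⟨P i, hP' i⟩)
        (OpFunctor.cell_comm_of_iso
          (F := (A.toOpStr.inclusion (isProjective C) hP).comp G') F e he c fun i => ⟨P i, hP' i⟩))
  exact ⟨⟨G', hcell⟩, extFunctor_preservesFiniteColimits F.functor, ⟨⟨e, he⟩⟩⟩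

omit hA in
/-- Uniqueness of right exact extensions of structure-preserving functors. -/
theorem nonempty_strIso_of_inclusion (G H : StrFunctor A T)
    [PreservesFiniteColimits G.functor] [PreservesFiniteColimits H.functor]
    (e : StrIso ((A.inclusion (isProjective C) hP).comp G)
      ((A.inclusion (isProjective C) hP).comp H)) : Nonempty (StrIso G H) := by
  obtain ⟨α, hα⟩ := exists_iso_of_restriction_iso G.functor H.functor e.iso
  refine ⟨⟨α, fun o X => ?_⟩⟩
  refine congrArg (fun β => NatTrans.app β X) (natTrans_ext_of_projective
    (SlotRightExact.precomp (hT o) G.functor).epi_map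
    (α := Functor.whiskerRight (NatTrans.pi fun _ => α.hom) (T.op o) ≫ (H.opNatIso o).hom)
    (β := (G.opNatIso o).hom ≫ Functor.whiskerLeft (A.op o) α.hom) fun P hP' => ?_)
  have h := e.opIso_comm o fun i => ⟨P i, hP' i⟩
  exact comp_eq_of_comp_id (congrArg (T.op o).map (funext fun i => hα ⟨P i, hP' i⟩))
    (G.functor.map_id _) (H.functor.map_id _)
    (hα (((A.restrict (isProjective C) hP).op o).obj fun i => ⟨P i, hP' i⟩)) h

end Completion

/-! ### Calculus of structure-preserving isomorphisms -/

section StrIsos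

variable {S : StructType.{w₁, w₂}} {C : Type u} [Category.{v} C] {D : Type u'} [Category.{v'} D]
  {E : Type uE} [Category.{vE} E] {A : Str S C} {B : Str S D} {T : Str S E}

theorem OpFunctor.id_opIso_natural {X Y : C} (f : X ⟶ Y) : f ≫ 𝟙 Y = 𝟙 X ≫ (𝟭 C).map f := by
  simp

/-- The identity commutes with the operations. -/
def OpFunctor.id (A : OpStr S C) : OpFunctor A A where
  functor := 𝟭 C
  opIso _ _ := Iso.refl _
  opIso_natural o _ _ f := OpFunctor.id_opIso_natural ((A.op o).map f)

theorem OpFunctor.termIso_id (A : OpStr S C) {n : ℕ} (t : StructTerm S.arity n) (X : Fin n → C) :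
    ((OpFunctor.id A).termIso t X).hom = 𝟙 _ := by
  induction t with
  | var i => rfl
  | op o args ih =>
    exact (Category.comp_id _).trans ((congrArg (A.op o).map (funext ih)).trans
      ((A.op o).map_id _))

/-- The identity as a structure-preserving functor. -/
def StrFunctor.id (A : Str S C) : StrFunctor A A where
  toOpFunctor := OpFunctor.id A.toOpStr
  cell_comm c X := by
    rw [OpFunctor.termIso_id, OpFunctor.termIso_id]
    exact OpFunctor.id_opIso_natural ((A.cell c).app X)

namespace StrIso

variable {F G H : StrFunctor A B}

theorem paste_map {a b c : C} (T : C ⥤ D) {a' b' c' : D} {f : a ⟶ b} {g : b ⟶ c} {k : a ⟶ c}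
    {p : T.obj a ⟶ a'} {q : T.obj b ⟶ b'} {r : T.obj c ⟶ c'} {f' : a' ⟶ b'} {g' : b' ⟶ c'}
    (hk : k = f ≫ g) (hf : T.map f ≫ q = p ≫ f') (hg : T.map g ≫ r = q ≫ g') :
    T.map k ≫ r = p ≫ f' ≫ g' := by
  rw [hk, T.map_comp, Category.assoc, hg, ← Category.assoc, hf, Category.assoc]

theorem paste_map_inv {a b : C} (T : C ⥤ D) {a' b' : D} {f : a ⟶ b} {g : b ⟶ a}
    {p : T.obj a ⟶ a'} {q : T.obj b ⟶ b'} {i : a' ≅ b'} (hg : g ≫ f = 𝟙 b)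
    (hf : T.map f ≫ q = p ≫ i.hom) : T.map g ≫ p = q ≫ i.inv := by
  rw [Iso.eq_comp_inv, Category.assoc, ← hf, ← Category.assoc, ← T.map_comp, hg, T.map_id,
    Category.id_comp]

/-- Composition of structure-preserving isomorphisms. -/
def trans (e : StrIso F G) (e' : StrIso G H) : StrIso F H where
  iso := e.iso ≪≫ e'.iso
  opIso_comm o X := paste_map (B.op o) (b := fun i => G.functor.obj (X i)) rfl
    (e.opIso_comm o X) (e'.opIso_comm o X)

/-- The inverse of a structure-preserving isomorphism. -/
def symm (e : StrIso F G) : StrIso G F where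
  iso := e.iso.symm
  opIso_comm o X := paste_map_inv (B.op o) (i := e.iso.app ((A.op o).obj X))
    (funext fun i => e.iso.inv_hom_id_app (X i)) (e.opIso_comm o X)

theorem whisker_square {a b : D} {c d : E} (K : D ⥤ E) {a' b' : D} {f : a ⟶ b} {p : a ⟶ a'}
    {q : b ⟶ b'} {f' : a' ⟶ b'} {x : c ⟶ d} {y : c ⟶ K.obj a} {z : d ⟶ K.obj b}
    (h : f ≫ q = p ≫ f') (h' : x ≫ z = y ≫ K.map f) :
    x ≫ z ≫ K.map q = (y ≫ K.map p) ≫ K.map f' := by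
  rw [← Category.assoc, h', Category.assoc, ← K.map_comp, h, K.map_comp, Category.assoc]

theorem comp_square₂ {a b c a' b' c' : D} {m : a ⟶ b} {n : b ⟶ c} {m' : a' ⟶ b'} {n' : b' ⟶ c'}
    {f : a ⟶ a'} {g : b ⟶ b'} {h : c ⟶ c'} (hm : f ≫ m' = m ≫ g) (hn : n ≫ h = g ≫ n') :
    f ≫ m' ≫ n' = (m ≫ n) ≫ h := by
  rw [← Category.assoc, hm, Category.assoc, Category.assoc, hn]

/-- Whiskering of a structure-preserving isomorphism. -/
def whiskerRight (e : StrIso F G) (K : StrFunctor B T) : StrIso (F.comp K) (G.comp K) where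
  iso := Functor.isoWhiskerRight e.iso K.functor
  opIso_comm o X := whisker_square K.functor (e.opIso_comm o X)
    (K.opIso_natural o (fun i => F.functor.obj (X i)) (fun i => G.functor.obj (X i))
      fun i => e.iso.hom.app (X i))

theorem id_square {a : C} (T : C ⥤ D) {c : D} {f : a ⟶ a} (hf : f = 𝟙 a) {p q : T.obj a ⟶ c}
    {r : c ⟶ c} (hr : r = 𝟙 c) (h : p = q) : T.map f ≫ p = q ≫ r := by
  rw [hf, hr, h, T.map_id, Category.id_comp, Category.comp_id]

/-- Whiskering of a structure-preserving isomorphism. -/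
def whiskerLeft (K : StrFunctor A B) {F G : StrFunctor B T} (e : StrIso F G) :
    StrIso (K.comp F) (K.comp G) where
  iso := Functor.isoWhiskerLeft K.functor e.iso
  opIso_comm o X := (comp_square₂ (e.opIso_comm o fun i => K.functor.obj (X i))
    (e.iso.hom.naturality (K.opIso o X).hom))

/-- Associativity of the composition of structure-preserving functors. -/
def assoc {P : Type uP} [Category.{vP} P] {R : Str S P} (F : StrFunctor A B) (G : StrFunctor B T)
    (K : StrFunctor T R) : StrIso ((F.comp G).comp K) (F.comp (G.comp K)) where
  iso := Functor.associator _ _ _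
  opIso_comm o X := by
    have h : (K.opIso o fun i => G.functor.obj (F.functor.obj (X i))).hom ≫
          K.functor.map ((G.opIso o fun i => F.functor.obj (X i)).hom ≫
            G.functor.map (F.opIso o X).hom) =
        ((K.opIso o fun i => G.functor.obj (F.functor.obj (X i))).hom ≫
          K.functor.map (G.opIso o fun i => F.functor.obj (X i)).hom) ≫
            K.functor.map (G.functor.map (F.opIso o X).hom) := by
      rw [K.functor.map_comp, Category.assoc]
    exact id_square (R.op o) rfl rfl h.symm

/-- The identity is neutral for the composition of structure-preserving functors. -/
def compId (F : StrFunctor A B) : StrIso (F.comp (StrFunctor.id B)) F where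
  iso := Functor.rightUnitor _
  opIso_comm o X := id_square (B.op o) rfl rfl (Category.id_comp (F.opIso o X).hom).symm

end StrIso

end StrIsos

/-! ### Universal property and uniqueness of the completion -/

section Completion

variable {S : StructType.{w₁, w₂}} {C : Type u} [Category.{v} C] [Abelian C]
  [EnoughProjectives C] {A : Str S C} (hA : A.RightExact) (hP : A.Closed (isProjective C))

include hA

theorem isAbelianCompletion_inclusion
    (Φ : ∀ (E : Type uE) [Category.{vE} E] [Abelian E], Str S E → Prop) :
    IsAbelianCompletion Φ (A.inclusion (isProjective C) hP) where
  rightExact := hA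
  additive := inferInstanceAs ((isProjective C).ι.Additive)
  exists_extension _ _ _ _ hT _ F _ := exists_strFunctor_extension hA hP hT F
  unique_extension _ _ _ _ hT _ G H _ _ h := h.elim (nonempty_strIso_of_inclusion hP hT G H)

theorem exists_equivalence_of_isAbelianCompletion
    (Φ : ∀ (E : Type u) [Category.{v} E] [Abelian E], Str S E → Prop) (hΦ : Φ C A)
    {D : Type u} [Category.{v} D] [Abelian D] {B : Str S D} (hΦ' : Φ D B)
    (j : StrFunctor (A.restrict (isProjective C) hP) B) (hj : IsAbelianCompletion Φ j) :
    ∃ F : StrFunctor A B, F.functor.IsEquivalence ∧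
      Nonempty (StrIso ((A.inclusion (isProjective C) hP).comp F) j) ∧
      ∀ G : StrFunctor A B, PreservesFiniteColimits G.functor →
        Nonempty (StrIso ((A.inclusion (isProjective C) hP).comp G) j) →
        Nonempty (StrIso F G) := by
  have hι : (A.inclusion (isProjective C) hP).functor.Additive :=
    inferInstanceAs ((isProjective C).ι.Additive)
  have := hj.additive
  obtain ⟨F, hF, ⟨eF⟩⟩ := exists_strFunctor_extension hA hP hj.rightExact j
  obtain ⟨H, hH, ⟨eH⟩⟩ := hj.exists_extension C A hA hΦ (A.inclusion (isProjective C) hP) hι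
  -- On the side of `C` a plain natural isomorphism is enough for an equivalence, whereas on the
  -- side of `D` the uniqueness clause of `hj` demands a structure-preserving isomorphism after `j`.
  obtain ⟨α, -⟩ := exists_iso_of_restriction_iso (F.functor ⋙ H.functor) (𝟭 C)
    (Functor.isoWhiskerRight eF.iso H.functor ≪≫ eH.iso)
  obtain ⟨β⟩ := hj.unique_extension D B hj.rightExact hΦ' (H.comp F) (StrFunctor.id B)
    (inferInstanceAs (PreservesFiniteColimits (H.functor ⋙ F.functor)))
    (inferInstanceAs (PreservesFiniteColimits (𝟭 D)))
    ⟨((StrIso.assoc j H F).symm.trans (eH.whiskerRight F)).trans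
      (eF.trans (StrIso.compId j).symm)⟩
  exact ⟨F, (CategoryTheory.Equivalence.mk F.functor H.functor α.symm β.iso).isEquivalence_functor, ⟨eF⟩,
    fun G hG ⟨eG⟩ => nonempty_strIso_of_inclusion hP hj.rightExact F G (eF.trans eG.symm)⟩

theorem exists_equivalence_of_projectives
    {C' : Type u'} [Category.{v'} C'] [Abelian C'] [EnoughProjectives C']
    {A' : Str S C'} (hA' : A'.RightExact) (hP' : A'.Closed (isProjective C'))
    (E : StrFunctor (A.restrict (isProjective C) hP) (A'.restrict (isProjective C') hP'))
    (hE : E.functor.Additive) (hE' : E.functor.IsEquivalence) :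
    ∃ F : StrFunctor A A', F.functor.IsEquivalence ∧
      Nonempty (StrIso ((A.inclusion (isProjective C) hP).comp F)
        (E.comp (A'.inclusion (isProjective C') hP'))) ∧
      ∀ G : StrFunctor A A', PreservesFiniteColimits G.functor →
        Nonempty (StrIso ((A.inclusion (isProjective C) hP).comp G)
          (E.comp (A'.inclusion (isProjective C') hP'))) →
        Nonempty (StrIso F G) := by
  have : (E.comp (A'.inclusion (isProjective C') hP')).functor.Additive :=
    inferInstanceAs ((E.functor ⋙ (isProjective C').ι).Additive)
  obtain ⟨F, hF, ⟨eF⟩⟩ := exists_strFunctor_extension hA hP hA'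
    (E.comp (A'.inclusion (isProjective C') hP'))
  let e : (isProjective C).ι ⋙ F.functor ≅ E.functor ⋙ (isProjective C').ι := eF.iso
  have : E.functor.inv.Additive :=
    have : E.functor.asEquivalence.functor.Additive := hE
    inferInstanceAs (E.functor.asEquivalence.inverse.Additive)
  -- The quasi-inverse is only needed as a functor, so no structure is put on the inverse of `E`.
  let H : C' ⥤ C := extFunctor (E.functor.inv ⋙ (isProjective C).ι)
  let eH : (isProjective C').ι ⋙ H ≅ E.functor.inv ⋙ (isProjective C).ι := extFunctorIso _
  obtain ⟨α, -⟩ := exists_iso_of_restriction_iso (F.functor ⋙ H) (𝟭 C)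
    (Functor.isoWhiskerRight e H ≪≫ Functor.isoWhiskerLeft E.functor eH ≪≫
      Functor.isoWhiskerRight E.functor.asEquivalence.unitIso.symm (isProjective C).ι)
  obtain ⟨β, -⟩ := exists_iso_of_restriction_iso (H ⋙ F.functor) (𝟭 C')
    (Functor.isoWhiskerRight eH F.functor ≪≫ Functor.isoWhiskerLeft E.functor.inv e ≪≫
      Functor.isoWhiskerRight E.functor.asEquivalence.counitIso (isProjective C').ι)
  exact ⟨F, (CategoryTheory.Equivalence.mk F.functor H α.symm β).isEquivalence_functor, ⟨eF⟩,
    fun G hG ⟨eG⟩ => nonempty_strIso_of_inclusion hP hA' F G (eF.trans eG.symm)⟩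

end Completion

/-! ### Restricting structure-preserving functors to full subcategories -/

section Restriction

variable {S : StructType.{w₁, w₂}} {C : Type u} [Category.{v} C] {D : Type u'} [Category.{v'} D]

theorem cancel_cells {a b c d : D} {a' b' : D} {x : a ⟶ b} {s : a ≅ a'} {t : b ⟶ b'} {y : a' ⟶ b'}
    {p : b' ⟶ d} {q : a' ⟶ c} {z : c ⟶ d} {t' : b ⟶ d} {s' : a ⟶ c}
    (h : x ≫ t = s.hom ≫ y) (ht : t' = t ≫ p) (hs : s' = s.hom ≫ q) (h' : x ≫ t' = s' ≫ z) :
    y ≫ p = q ≫ z := by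
  rw [ht, hs] at h'
  rw [← cancel_epi s.hom, ← Category.assoc, ← h, Category.assoc, h', Category.assoc]

/-- The restriction of a functor commuting with the operations to full subcategories. -/
def OpFunctor.restrict {A : OpStr S C} {B : OpStr S D} (F : OpFunctor A B) (Q : ObjectProperty C)
    (Q' : ObjectProperty D) (h : A.Closed Q) (h' : B.Closed Q')
    (hF : ∀ X, Q X → Q' (F.functor.obj X)) : OpFunctor (A.restrict Q h) (B.restrict Q' h') where
  functor := Q'.lift (Q.ι ⋙ F.functor) fun X => hF X.obj X.property
  opIso o X := Q'.isoMk (F.opIso o fun i => (X i).obj)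
  opIso_natural o X Y f := Q'.hom_ext (F.opIso_natural o (fun i => (X i).obj) (fun i => (Y i).obj)
    fun i => (f i).hom)

/-- The restriction of a structure-preserving functor to full subcategories. -/
def StrFunctor.restrict {A : Str S C} {B : Str S D} (F : StrFunctor A B) (Q : ObjectProperty C)
    (Q' : ObjectProperty D) (h : A.Closed Q) (h' : B.Closed Q')
    (hF : ∀ X, Q X → Q' (F.functor.obj X)) : StrFunctor (A.restrict Q h) (B.restrict Q' h') where
  toOpFunctor := F.toOpFunctor.restrict Q Q' h h' hF
  cell_comm c X := by
    let R := F.toOpFunctor.restrict Q Q' h h' hF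
    -- Restricting and then including agrees with including and then applying `F`, via the identity
    -- isomorphism; the inclusion is then cancelled by `cancel_cells`.
    have h1 := OpFunctor.cell_comm_of_iso (F := R.comp (B.toOpStr.inclusion Q' h'))
      ((A.inclusion Q h).comp F) (Iso.refl _) (fun o X => StrIso.id_square (B.op o) rfl rfl
        (((congrArg (_ ≫ ·) (F.functor.map_id _)).trans (Category.comp_id _)).trans
          (Category.id_comp _).symm)) c X
    have h2 := (B.inclusion Q' h').cell_comm c fun i => R.functor.obj (X i)
    exact Q'.hom_ext (cancel_cells h2 (OpFunctor.termIso_comp R (B.toOpStr.inclusion Q' h') _ X)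
      (OpFunctor.termIso_comp R (B.toOpStr.inclusion Q' h') _ X) h1)

end Restriction

/-! ### Recovering the unit from the tensor product -/

section Unit

variable {C : Type u} [Category.{v} C] [MonoidalCategory C] {D : Type u'} [Category.{v'} D]
  [MonoidalCategory D]

/-- Tensoring with an object isomorphic to the unit is isomorphic to the identity functor, hence
full on isomorphisms; faithfulness is the next lemma. -/
theorem exists_whiskerRight_eq {Z : D} (i : Z ≅ 𝟙_ D) {A B : D} (g : A ⊗ Z ≅ B ⊗ Z) :
    ∃ e : A ≅ B, e.hom ▷ Z = g.hom := by
  refine ⟨(ρ_ A).symm ≪≫ whiskerLeftIso A i.symm ≪≫ g ≪≫ whiskerLeftIso B i ≪≫ ρ_ B, ?_⟩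
  rw [← cancel_mono (B ◁ i.hom), ← whisker_exchange, ← cancel_mono (ρ_ B).hom]
  simp

theorem whiskerRight_injective_of_iso {Z : D} (i : Z ≅ 𝟙_ D) {A B : D} {f g : A ⟶ B}
    (h : f ▷ Z = g ▷ Z) : f = g := by
  have h1 : f ▷ 𝟙_ D = g ▷ 𝟙_ D := by
    rw [← cancel_epi (A ◁ i.hom), whisker_exchange, whisker_exchange, h]
  simpa using h1

/-- An equivalence which commutes with the tensor product, compatibly with the associativity
constraints, preserves the unit object. -/
theorem exists_unitIso (F : C ⥤ D) [F.IsEquivalence]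
    (μ : ∀ X Y : C, F.obj X ⊗ F.obj Y ≅ F.obj (X ⊗ Y))
    (hl : ∀ {X Y : C} (f : X ⟶ Y) (X' : C),
      F.map f ▷ F.obj X' ≫ (μ Y X').hom = (μ X X').hom ≫ F.map (f ▷ X'))
    (hr : ∀ {X Y : C} (X' : C) (f : X ⟶ Y),
      F.obj X' ◁ F.map f ≫ (μ X' Y).hom = (μ X' X).hom ≫ F.map (X' ◁ f))
    (ha : ∀ X Y Z : C, (μ X Y).hom ▷ F.obj Z ≫ (μ (X ⊗ Y) Z).hom ≫ F.map (α_ X Y Z).hom =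
      (α_ (F.obj X) (F.obj Y) (F.obj Z)).hom ≫ F.obj X ◁ (μ Y Z).hom ≫ (μ X (Y ⊗ Z)).hom) :
    ∃ ε : 𝟙_ D ≅ F.obj (𝟙_ C),
      (∀ X : C, (λ_ (F.obj X)).hom =
        ε.hom ▷ F.obj X ≫ (μ (𝟙_ C) X).hom ≫ F.map (λ_ X).hom) ∧
      ∀ X : C, (ρ_ (F.obj X)).hom =
        F.obj X ◁ ε.hom ≫ (μ X (𝟙_ C)).hom ≫ F.map (ρ_ X).hom := by
  let X₀ := F.objPreimage (𝟙_ D)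
  let i : F.obj X₀ ≅ 𝟙_ D := F.objObjPreimageIso _
  -- `F 𝟙` acts as a left unit on the image of `F` through `l`. It remains to find one `e : 𝟙 ≅ F 𝟙`
  -- matching `l` with the left unitors at every object.
  let l : ∀ X, F.obj (𝟙_ C) ⊗ F.obj X ≅ F.obj X := fun X => μ (𝟙_ C) X ≪≫ F.mapIso (λ_ X)
  have hl_nat : ∀ {X Y : C} (f : X ⟶ Y),
      F.obj (𝟙_ C) ◁ F.map f ≫ (l Y).hom = (l X).hom ≫ F.map f := fun {X Y} f => by
    simp only [l, Iso.trans_hom, Functor.mapIso_hom, Category.assoc]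
    rw [← Category.assoc, hr, Category.assoc, ← F.map_comp, leftUnitor_naturality, F.map_comp]
  have hl_tensor : ∀ X Y : C, F.obj (𝟙_ C) ◁ (μ X Y).hom ≫ (l (X ⊗ Y)).hom =
      (α_ _ _ _).inv ≫ (l X).hom ▷ F.obj Y ≫ (μ X Y).hom := fun X Y => by
    rw [Iso.eq_inv_comp]
    simp only [l, Iso.trans_hom, Functor.mapIso_hom, comp_whiskerRight, Category.assoc]
    rw [hl, ← Category.assoc (F.obj (𝟙_ C) ◁ _), ← Category.assoc, ← ha]
    simp only [Category.assoc]
    rw [← F.map_comp, leftUnitor_tensor_hom, Iso.hom_inv_id_assoc]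
  -- Matching at `X₀` alone determines `e`, since `F X₀` is isomorphic to the unit.
  obtain ⟨e, he⟩ := exists_whiskerRight_eq i (λ_ (F.obj X₀) ≪≫ (l X₀).symm)
  have he₀ : e.hom ▷ F.obj X₀ ≫ (l X₀).hom = (λ_ (F.obj X₀)).hom := by
    rw [he]
    simp
  have he₁ : ∀ X, e.hom ▷ F.obj (X₀ ⊗ X) ≫ (l (X₀ ⊗ X)).hom = (λ_ (F.obj (X₀ ⊗ X))).hom :=
    fun X => by
      rw [← cancel_epi (𝟙_ D ◁ (μ X₀ X).hom), ← Category.assoc, whisker_exchange, Category.assoc,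
        hl_tensor, leftUnitor_naturality, leftUnitor_tensor_hom, ← he₀, comp_whiskerRight]
      simp
  have he₂ : ∀ X, e.hom ▷ F.obj X ≫ (l X).hom = (λ_ (F.obj X)).hom := fun X => by
    -- Every object has the form `X₀ ⊗ X` up to isomorphism, so the identity spreads from `X₀` to
    -- all objects by naturality of `l`.
    let t : X₀ ⊗ X ≅ X := F.preimageIso ((μ X₀ X).symm ≪≫ whiskerRightIso i (F.obj X) ≪≫ λ_ _)
    rw [← cancel_epi (𝟙_ D ◁ F.map t.hom), ← Category.assoc, whisker_exchange, Category.assoc,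
      hl_nat, leftUnitor_naturality, ← he₁, Category.assoc]
  refine ⟨e, fun X => (he₂ X).symm, fun X => whiskerRight_injective_of_iso i ?_⟩
  -- The right unit law may be tested after tensoring with `F X₀`, where the triangle identity turns
  -- it into the left one.
  have h : ((μ X (𝟙_ C)).hom ≫ F.map (ρ_ X).hom) ▷ F.obj X₀ =
      (α_ _ _ _).hom ≫ F.obj X ◁ (l X₀).hom := by
    rw [← cancel_mono (μ X X₀).hom]
    simp only [l, Iso.trans_hom, Functor.mapIso_hom, comp_whiskerRight, Category.assoc,
      MonoidalCategory.whiskerLeft_comp]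
    rw [hl, hr, ← triangle, F.map_comp, ← Category.assoc (F.obj X ◁ _),
      ← Category.assoc (α_ _ _ _).hom, ← ha]
    simp only [Category.assoc]
  rw [comp_whiskerRight, h, associator_naturality_middle_assoc,
    ← MonoidalCategory.whiskerLeft_comp, he₂, triangle]

open Functor.LaxMonoidal in
/-- A natural isomorphism compatible with the tensor products is compatible with the units. -/
theorem isMonoidal_of_tensor {F G : C ⥤ D} [F.Monoidal] [G.Monoidal] (α : F ≅ G)
    (h : ∀ X Y : C, μ F X Y ≫ α.hom.app (X ⊗ Y) = (α.hom.app X ⊗ₘ α.hom.app Y) ≫ μ G X Y) :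
    NatTrans.IsMonoidal α.hom where
  tensor := h
  unit := by
    -- Tested after tensoring with `G 𝟙`, the unit condition follows from left unitality of `F` and
    -- of `G`.
    refine whiskerRight_injective_of_iso (Functor.Monoidal.εIso G).symm ?_
    have : IsIso (μ G (𝟙_ C) (𝟙_ C) ≫ G.map (λ_ (𝟙_ C)).hom) := inferInstance
    rw [← cancel_mono (μ G (𝟙_ C) (𝟙_ C) ≫ G.map (λ_ (𝟙_ C)).hom),
      ← left_unitality G (𝟙_ C), ← cancel_epi (𝟙_ D ◁ α.hom.app (𝟙_ C)),
      leftUnitor_naturality, left_unitality F (𝟙_ C), Category.assoc, Category.assoc,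
      α.hom.naturality, ← Category.assoc (μ F _ _), h,
      MonoidalCategory.tensorHom_def, ← Category.assoc (𝟙_ D ◁ _), whisker_exchange,
      comp_whiskerRight]
    simp only [Category.assoc]

end Unit

/-! ### Linear tensor structures without unit versus monoidal functors -/

section TensorStructures

variable (k : Type w₂) {C : Type u} [Category.{v} C] [MonoidalCategory C]
  {D : Type u'} [Category.{v'} D] [MonoidalCategory D]

theorem nonempty_insertSlot_iso (X : Fin 2 → C) :
    Nonempty (insertSlot X 0 ⋙ (tensorOpStr k C).op .tensor ≅ tensorRight (X 1)) ∧
    Nonempty (insertSlot X 1 ⋙ (tensorOpStr k C).op .tensor ≅ tensorLeft (X 0)) := by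
  have key (i j : Fin 2) : (j = i → Nonempty (insertSlot X i ⋙ Pi.eval _ j ≅ 𝟭 C)) ∧
      (j ≠ i → Nonempty (insertSlot X i ⋙ Pi.eval _ j ≅ (Functor.const C).obj (X j))) := by
    constructor
    · intro h
      exact ⟨eqToIso (if_pos h)⟩
    · intro h
      exact ⟨eqToIso (if_neg h)⟩
  obtain ⟨a⟩ := (key 0 0).1 rfl
  obtain ⟨b⟩ := (key 0 1).2 (by decide)
  obtain ⟨c⟩ := (key 1 0).2 (by decide)
  obtain ⟨d⟩ := (key 1 1).1 rfl
  refine ⟨⟨NatIso.ofComponents (fun Y => a.app Y ⊗ᵢ b.app Y) fun {Y Z} f => ?_⟩,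
    ⟨NatIso.ofComponents (fun Y => c.app Y ⊗ᵢ d.app Y) fun {Y Z} f => ?_⟩⟩
  · have h1 := a.hom.naturality f
    have h2 := b.hom.naturality f
    have h3 := (tensorHom_comp_tensorHom _ _ _ _).trans
      ((congrArg₂ (· ⊗ₘ ·) h1 h2).trans (tensorHom_comp_tensorHom _ _ _ _).symm)
    exact h3.trans (congrArg (_ ≫ ·) (tensorHom_id f (X 1)))
  · have h1 := c.hom.naturality f
    have h2 := d.hom.naturality f
    have h3 := (tensorHom_comp_tensorHom _ _ _ _).trans
      ((congrArg₂ (· ⊗ₘ ·) h1 h2).trans (tensorHom_comp_tensorHom _ _ _ _).symm)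
    exact h3.trans (congrArg (_ ≫ ·) (id_tensorHom (X 0) f))

/-- Duals make tensoring on either side a left adjoint. -/
theorem tensorOpStr_rightExact [RigidCategory C] : (tensorOpStr k C).RightExact := by
  intro o X i
  change Fin 2 → C at X
  change Fin 2 at i
  obtain ⟨⟨e⟩, ⟨e'⟩⟩ := nonempty_insertSlot_iso k X
  fin_cases i
  · have := (tensorRightAdjunction (X 1) (HasRightDual.rightDual (X 1))).leftAdjoint_preservesColimits
    have : PreservesFiniteColimits (tensorRight (X 1)) := inferInstance
    exact preservesFiniteColimits_of_natIso e.symm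
  · have := (tensorLeftAdjunction (HasLeftDual.leftDual (X 0)) (X 0)).leftAdjoint_preservesColimits
    have : PreservesFiniteColimits (tensorLeft (X 0)) := inferInstance
    exact preservesFiniteColimits_of_natIso e'.symm

variable {k} [Field k] [Preadditive C] [Linear k C] [Preadditive D] [Linear k D]

namespace StrFunctor

variable (K : StrFunctor (tensorStr k C) (tensorStr k D))

/-- The tensorator of a functor preserving the tensor structure. -/
def tensorator (X Y : C) : K.functor.obj X ⊗ K.functor.obj Y ≅ K.functor.obj (X ⊗ Y) :=
  K.opIso .tensor (![X, Y] : Fin 2 → C)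

theorem opIso_eq_tensorator (X : Fin 2 → C) :
    K.opIso .tensor X = K.tensorator (X 0) (X 1) := by
  obtain ⟨x, y, rfl⟩ : ∃ x y, X = ![x, y] := ⟨X 0, X 1, by ext i; fin_cases i <;> rfl⟩
  rfl

theorem tensorator_natural {X Y X' Y' : C} (f : X ⟶ X') (g : Y ⟶ Y') :
    (K.functor.map f ⊗ₘ K.functor.map g) ≫ (K.tensorator X' Y').hom =
      (K.tensorator X Y).hom ≫ K.functor.map (f ⊗ₘ g) :=
  K.opIso_natural .tensor (![X, Y] : Fin 2 → C) (![X', Y'] : Fin 2 → C)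
    (Fin.cons (α := fun i : Fin 2 => (![X, Y] : Fin 2 → C) i ⟶ (![X', Y'] : Fin 2 → C) i) f
      (Fin.cons g fun i => i.elim0))

omit [MonoidalCategory C] [Preadditive C] [Linear k C] [Preadditive D] [Linear k D] [Field k]
  [Category.{v} C] in
-- Removes the identities that the variables contribute to `termIso`, turning the associator cell
-- condition into the hexagon of a monoidal functor.
theorem assoc_of_eq {a b c ab bc d d' : D} {m m' : a ⊗ b ⟶ ab} {p p' : b ⊗ c ⟶ bc}
    {n n' : ab ⊗ c ⟶ d} {q q' : a ⊗ bc ⟶ d'} {x : d ⟶ d'} (hm : m = m') (hp : p = p')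
    (hn : n = n') (hq : q = q')
    (h : (α_ a b c).hom ≫ ((𝟙 a ⊗ₘ ((𝟙 b ⊗ₘ 𝟙 c) ≫ p)) ≫ q) =
      ((((𝟙 a ⊗ₘ 𝟙 b) ≫ m) ⊗ₘ 𝟙 c) ≫ n) ≫ x) :
    m' ▷ c ≫ n' ≫ x = (α_ a b c).hom ≫ a ◁ p' ≫ q' := by
  subst hm hp hn hq
  simpa using h.symm

theorem tensorator_assoc (X Y Z : C) :
    (K.tensorator X Y).hom ▷ K.functor.obj Z ≫ (K.tensorator (X ⊗ Y) Z).hom ≫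
        K.functor.map (α_ X Y Z).hom =
      (α_ (K.functor.obj X) (K.functor.obj Y) (K.functor.obj Z)).hom ≫
        K.functor.obj X ◁ (K.tensorator Y Z).hom ≫ (K.tensorator X (Y ⊗ Z)).hom :=
  assoc_of_eq (congrArg Iso.hom (K.opIso_eq_tensorator _))
    (congrArg Iso.hom (K.opIso_eq_tensorator _)) (congrArg Iso.hom (K.opIso_eq_tensorator _))
    (congrArg Iso.hom (K.opIso_eq_tensorator _))
    (K.cell_comm .assoc (![X, Y, Z] : Fin 3 → C))

theorem map_smul_id (r : k) (X : C) :
    K.functor.map (r • 𝟙 X) = r • 𝟙 (K.functor.obj X) := by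
  have h : (r • 𝟙 (K.functor.obj X)) ≫ 𝟙 _ = 𝟙 _ ≫ K.functor.map (r • 𝟙 X) :=
    K.cell_comm (.scalar r) (fun _ => X)
  rw [Category.comp_id, Category.id_comp] at h
  exact h.symm

/-- The scalar cells give linearity on identities, and `r • f` is `(r • 𝟙 X) ≫ f`. -/
theorem linear [K.functor.Additive] : K.functor.Linear k where
  map_smul {X Y} f r := by
    have h : r • f = (r • 𝟙 X) ≫ f := by simp
    rw [h, K.functor.map_comp, map_smul_id]
    simp

theorem exists_coreMonoidal [K.functor.IsEquivalence] :
    ∃ M : K.functor.CoreMonoidal, M.μIso = K.tensorator := by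
  have hl : ∀ {X Y : C} (f : X ⟶ Y) (X' : C), K.functor.map f ▷ K.functor.obj X' ≫
      (K.tensorator Y X').hom = (K.tensorator X X').hom ≫ K.functor.map (f ▷ X') :=
    fun f X' => by
      rw [← tensorHom_id, ← tensorHom_id, ← tensorator_natural, K.functor.map_id]
  have hr : ∀ {X Y : C} (X' : C) (f : X ⟶ Y), K.functor.obj X' ◁ K.functor.map f ≫
      (K.tensorator X' Y).hom = (K.tensorator X' X).hom ≫ K.functor.map (X' ◁ f) :=
    fun X' f => by
      rw [← id_tensorHom, ← id_tensorHom, ← tensorator_natural, K.functor.map_id]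
  obtain ⟨ε, h1, h2⟩ := exists_unitIso K.functor K.tensorator hl hr K.tensorator_assoc
  exact ⟨{ εIso := ε
           μIso := K.tensorator
           μIso_hom_natural_left := hl
           μIso_hom_natural_right := hr
           associativity := K.tensorator_assoc
           left_unitality := h1
           right_unitality := h2 }, rfl⟩

/-- An equivalence preserving the tensor structure without unit underlies a linear monoidal
functor. -/
theorem exists_monoidal [K.functor.Additive] [K.functor.IsEquivalence] :
    ∃ (_ : K.functor.Monoidal) (_ : K.functor.Linear k),
      Nonempty (StrIso (monoidalStrFunctor k K.functor) K) := by
  obtain ⟨M, hM⟩ := K.exists_coreMonoidal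
  refine ⟨M.toMonoidal, K.linear, ⟨⟨Iso.refl _, fun o X => ?_⟩⟩⟩
  refine StrIso.id_square ((tensorStr k D).op o) rfl rfl ?_
  cases o
  refine (congrArg Iso.hom (K.opIso_eq_tensorator X)).trans ?_
  rw [← hM]
  rfl

end StrFunctor

end TensorStructures

/-! ### Rigid tensor categories and their projectives -/

section FiniteTensorCategories

variable {k : Type w₂} [Field k]
  {C : Type u} [Category.{v} C] [Abelian C] [Linear k C] [MonoidalCategory C] [RigidCategory C]
  {D : Type u'} [Category.{v'} D] [Abelian D] [Linear k D] [MonoidalCategory D] [RigidCategory D]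

/-- An equivalence preserves and reflects projectivity; reflection gives essential surjectivity of
the restriction. -/
theorem exists_projTensor_equivalence (F : C ⥤ D) [F.Monoidal] [F.Additive] [F.Linear k]
    [F.IsEquivalence] : ∃ E : StrFunctor (projTensorStr k C) (projTensorStr k D),
      E.functor.Additive ∧ E.functor.IsEquivalence := by
  have hF : ∀ X, isProjective C X → isProjective D (F.obj X) := fun X hX =>
    (F.asEquivalence.map_projective_iff X).2 hX
  refine ⟨(monoidalStrFunctor k F).restrict _ _ (tensorOpStr_closed k C) (tensorOpStr_closed k D)
    hF, ⟨?_⟩, ?_⟩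
  · intro X Y f g
    exact (isProjective D).hom_ext F.map_add
  · let G := (isProjective D).lift ((isProjective C).ι ⋙ F) fun X => hF X.obj X.property
    have : G.EssSurj := ⟨fun Y => by
      let X := F.objPreimage Y.obj
      let i : F.obj X ≅ Y.obj := F.objObjPreimageIso Y.obj
      have hX : isProjective C X :=
        (F.asEquivalence.map_projective_iff X).1 (Projective.of_iso i.symm Y.property)
      exact ⟨⟨X, hX⟩, ⟨(isProjective D).isoMk i⟩⟩⟩
    exact { : G.IsEquivalence }

variable [EnoughProjectives C] [EnoughProjectives D]

theorem exists_monoidal_equivalence (E : StrFunctor (projTensorStr k C) (projTensorStr k D))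
    (hE : E.functor.Additive) (hE' : E.functor.IsEquivalence) :
    ∃ (F : C ⥤ D) (_ : F.Monoidal) (_ : F.Additive) (_ : F.Linear k), F.IsEquivalence ∧
      Nonempty (StrIso ((projTensorInclusion k C).comp (monoidalStrFunctor k F))
        (E.comp (projTensorInclusion k D))) := by
  obtain ⟨K, hK, ⟨e⟩, -⟩ := exists_equivalence_of_projectives
    (A := tensorStr k C) (A' := tensorStr k D) (tensorOpStr_rightExact k)
    (tensorOpStr_closed k C) (tensorOpStr_rightExact k) (tensorOpStr_closed k D) E hE hE'
  have := additive_of_preservesFiniteColimits K.functor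
  obtain ⟨hM, hL, ⟨e'⟩⟩ := K.exists_monoidal
  exact ⟨K.functor, hM, this, hL, hK, ⟨(e'.whiskerLeft (projTensorInclusion k C)).trans e⟩⟩

omit [EnoughProjectives D] in
theorem exists_isMonoidal_iso (F G : C ⥤ D) [F.Monoidal] [F.Additive] [F.Linear k]
    [G.Monoidal] [G.Additive] [G.Linear k] [PreservesFiniteColimits F]
    [PreservesFiniteColimits G]
    (e : StrIso ((projTensorInclusion k C).comp (monoidalStrFunctor k F))
      ((projTensorInclusion k C).comp (monoidalStrFunctor k G))) :
    ∃ α : F ≅ G, NatTrans.IsMonoidal α.hom := by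
  have : PreservesFiniteColimits (monoidalStrFunctor k F).functor := ‹PreservesFiniteColimits F›
  have : PreservesFiniteColimits (monoidalStrFunctor k G).functor := ‹PreservesFiniteColimits G›
  obtain ⟨α⟩ := nonempty_strIso_of_inclusion (A := tensorStr k C) (T := tensorStr k D)
    (tensorOpStr_closed k C) (tensorOpStr_rightExact k) _ _ e
  exact ⟨α.iso, isMonoidal_of_tensor (F := F) (G := G) α.iso fun X Y =>
    (α.opIso_comm .tensor (![X, Y] : Fin 2 → C)).symm⟩

end FiniteTensorCategories

/-! ### The main theorem -/

theorem mainTheorem1 :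
    -- `C` is an abelian completion of its full subcategory of projectives
    (∀ (S : StructType.{w₁, w₂}) (C : Type u) [Category.{v} C] [Abelian C] [EnoughProjectives C]
        (A : Str S C) (_ : A.RightExact) (hP : A.Closed (isProjective C))
        (Φ : ∀ (E : Type uE) [Category.{vE} E] [Abelian E], Str S E → Prop),
      IsAbelianCompletion Φ (A.inclusion (isProjective C) hP)) ∧
    -- any other abelian completion is equivalent to `C` under the projectives
    (∀ (S : StructType.{w₁, w₂}) (C : Type u) [Category.{v} C] [Abelian C] [EnoughProjectives C]
        (A : Str S C) (_ : A.RightExact) (hP : A.Closed (isProjective C))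
        (Φ : ∀ (E : Type u) [Category.{v} E] [Abelian E], Str S E → Prop) (_ : Φ C A)
        (D : Type u) [Category.{v} D] [Abelian D] (B : Str S D) (_ : Φ D B)
        (j : StrFunctor (A.restrict (isProjective C) hP) B) (_ : IsAbelianCompletion Φ j),
      ∃ F : StrFunctor A B, F.functor.IsEquivalence ∧
        Nonempty (StrIso ((A.inclusion (isProjective C) hP).comp F) j) ∧
        ∀ G : StrFunctor A B, PreservesFiniteColimits G.functor →
          Nonempty (StrIso ((A.inclusion (isProjective C) hP).comp G) j) →
          Nonempty (StrIso F G)) ∧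
    -- an abelian category with the same full subcategory of projectives is equivalent to `C`
    (∀ (S : StructType.{w₁, w₂})
        (C : Type u) [Category.{v} C] [Abelian C] [EnoughProjectives C]
        (A : Str S C) (_ : A.RightExact) (hP : A.Closed (isProjective C))
        (C' : Type u') [Category.{v'} C'] [Abelian C'] [EnoughProjectives C']
        (A' : Str S C') (_ : A'.RightExact) (hP' : A'.Closed (isProjective C'))
        (E : StrFunctor (A.restrict (isProjective C) hP) (A'.restrict (isProjective C') hP'))
        (_ : E.functor.Additive) (_ : E.functor.IsEquivalence),
      ∃ F : StrFunctor A A', F.functor.IsEquivalence ∧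
        Nonempty (StrIso ((A.inclusion (isProjective C) hP).comp F)
          (E.comp (A'.inclusion (isProjective C') hP'))) ∧
        ∀ G : StrFunctor A A', PreservesFiniteColimits G.functor →
          Nonempty (StrIso ((A.inclusion (isProjective C) hP).comp G)
            (E.comp (A'.inclusion (isProjective C') hP'))) →
          Nonempty (StrIso F G)) ∧
    -- finite tensor categories
    (∀ (k : Type w₂) [Field k] [IsAlgClosed k]
        (C : Type u) [Category.{v} C] [Abelian C] [Linear k C] [MonoidalCategory C]
        [MonoidalPreadditive C] [MonoidalLinear k C] [RigidCategory C]
        [IsFiniteTensorCategory k C]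
        (C' : Type u') [Category.{v'} C'] [Abelian C'] [Linear k C'] [MonoidalCategory C']
        [MonoidalPreadditive C'] [MonoidalLinear k C'] [RigidCategory C']
        [IsFiniteTensorCategory k C'],
      ((∃ (F : C ⥤ C') (_ : F.Monoidal) (_ : F.Additive), F.Linear k ∧ F.IsEquivalence) ↔
        ∃ E : StrFunctor (projTensorStr k C) (projTensorStr k C'),
          E.functor.Additive ∧ E.functor.IsEquivalence) ∧
      ∀ E : StrFunctor (projTensorStr k C) (projTensorStr k C'),
        E.functor.Additive → E.functor.IsEquivalence →
        (∃ (F : C ⥤ C') (_ : F.Monoidal) (_ : F.Additive) (_ : F.Linear k), F.IsEquivalence ∧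
          Nonempty (StrIso ((projTensorInclusion k C).comp (monoidalStrFunctor k F))
            (E.comp (projTensorInclusion k C')))) ∧
        ∀ (F G : C ⥤ C') [F.Monoidal] [F.Additive] [F.Linear k]
          [G.Monoidal] [G.Additive] [G.Linear k],
          PreservesFiniteColimits F → PreservesFiniteColimits G →
          Nonempty (StrIso ((projTensorInclusion k C).comp (monoidalStrFunctor k F))
            (E.comp (projTensorInclusion k C'))) →
          Nonempty (StrIso ((projTensorInclusion k C).comp (monoidalStrFunctor k G))
            (E.comp (projTensorInclusion k C'))) →
          ∃ α : F ≅ G, NatTrans.IsMonoidal α.hom) := by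
  refine ⟨fun S C _ _ _ A hA hP Φ => isAbelianCompletion_inclusion hA hP Φ,
    fun S C _ _ _ A hA hP Φ hΦ D _ _ B hΦ' j hj =>
      exists_equivalence_of_isAbelianCompletion hA hP Φ hΦ hΦ' j hj,
    fun S C _ _ _ A hA hP C' _ _ _ A' hA' hP' E hE hE' =>
      exists_equivalence_of_projectives hA hP hA' hP' E hE hE', ?_⟩
  intro k _ _ C _ _ _ _ _ _ _ _ C' _ _ _ _ _ _ _ _
  have : EnoughProjectives C := IsFiniteTensorCategory.enoughProjectives k
  have : EnoughProjectives C' := IsFiniteTensorCategory.enoughProjectives k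
  refine ⟨⟨fun ⟨F, _, _, _, _⟩ => exists_projTensor_equivalence F, fun ⟨E, hE, hE'⟩ => ?_⟩,
    fun E hE hE' => ⟨exists_monoidal_equivalence E hE hE', ?_⟩⟩
  · obtain ⟨F, h1, h2, h3, h4, -⟩ := exists_monoidal_equivalence E hE hE'
    exact ⟨F, h1, h2, h3, h4⟩
  · intro F G _ _ _ _ _ _ _ _ ⟨e⟩ ⟨e'⟩
    exact exists_isMonoidal_iso F G (e.trans e'.symm)
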